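/- Let $Q$ be a finite-dimensional smooth manifold, $k\ge 1$, and let $T^mQ=J^m_0(\mathbb R,Q)$ be the $m$-th order tangent bundle (the $m$-jets at $0$ of curves in $Q$), with natural coordinates $(q_0,\dots,q_m)$ and projections $\rho^m_r:T^mQ\to T^rQ$. Let $j_{r+1}:T^mQ\to T(T^rQ)$ ($r<m$) be the canonical injection $(q_0,\dots,q_m)\mapsto(q_0,\dots,q_r;q_1,\dots,q_{r+1})$, $J_r=\sum_{i=0}^{m-r}\frac{(r+i)!}{i!}dq_i\otimes\frac{\partial}{\partial q_{r+i}}$ the $r$-th vertical endomorphism and $\Delta_r=\sum_{i=0}^{m-r}\frac{(r+i)!}{i!}q_{i+1}\frac{\partial}{\partial q_{r+i}}$ the $r$-th canonical vector field of $T^mQ$, $d_{J_r}f=df\circ J_r$, and let $d_T$ be Tulczyjew's derivation, which maps functions and forms on $T^mQ$ to functions and forms on $T^{m+1}Q$, commutes with $d$, and is given on functions by $d_Tf=\sum_{i=0}^m q_{i+1}\frac{\partial f}{\partial q_i}$. Let $\mathcal L\in C^\infty(T^kQ)$ (no regularity of $\mathcal L$ is assumed), and let, on $T^{2k-1}Q$,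 $$\theta_{\mathcal L}=\sum_{r=1}^k\frac{(-1)^{r-1}}{r!}d_T^{r-1}d_{J_r}\mathcal L,\qquad \omega_{\mathcal L}=-d\theta_{\mathcal L},\qquad E_{\mathcal L}=\sum_{r=1}^k\frac{(-1)^{r-1}}{r!}d_T^{r-1}(\Delta_r(\mathcal L))-\mathcal L$$ be the Lagrangian forms and the Lagrangian energy, where forms and functions on $T^mQ$ with $m\le 2k-1$ are pulled back to $T^{2k-1}Q$. Let $\mathcal{FL}:T^{2k-1}Q\to T^*(T^{k-1}Q)$ be the Legendre–Ostrogradsky map, defined by $\theta_{\mathcal L}(u)=\langle \mathcal{FL}(p),T\rho^{2k-1}_{k-1}(u)\rangle$ for $u\in T_p(T^{2k-1}Q)$. Let $\mathcal W=T^{2k-1}Q\times_{T^{k-1}Q}T^*(T^{k-1}Q)$ with projections $\mathrm{pr}_1,\mathrm{pr}_2$ onto its two factors, let $\Omega=\mathrm{pr}_2^*\omega_{k-1}$, where $\omega_{k-1}=-d\theta_{k-1}$ is the canonical symplectic form of $T^*(T^{k-1}Q)$, let $H(p,\alpha)=\langle\alpha,j_k(p)\rangle-\mathcal L(\rho^{2k-1}_k(p))$,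 and let $\mathcal W_o=\operatorname{graph}\mathcal{FL}\subset\mathcal W$. Let $X$ be a smooth vector field of $\mathcal W$ at support on $\mathcal W_o$ which is tangent to $\mathcal W_o$ and is a solution of the unified equation $$\bigl[i(X)\Omega-dH\bigr]\big|_{\mathcal W_o}=0 .$$ Then there is a unique smooth vector field $X_{\mathcal L}$ on $T^{2k-1}Q$ with $X_{\mathcal L}(\mathrm{pr}_1(w))=T\mathrm{pr}_1(X(w))$ for every $w\in\mathcal W_o$; it is a Lagrangian vector field, that is, $i(X_{\mathcal L})\omega_{\mathcal L}=dE_{\mathcal L}$ on $T^{2k-1}Q$; and if $\sigma:I\subset\mathbb R\to\mathcal W$ is an integral curve of $X$ with $\sigma(I)\subset\mathcal W_o$, then $\sigma_{\mathcal L}=\mathrm{pr}_1\circ\sigma:I\to T^{2k-1}Q$ is an integral curve of $X_{\mathcal L}$. -/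

import Mathlib

open scoped Manifold ContDiff Topology
open Bundle

noncomputable section

namespace HigherOrder

section Calculus

variable {E F P : Type*} [NormedAddCommGroup E] [NormedSpace ℝ E]
  [NormedAddCommGroup F] [NormedSpace ℝ F] [NormedAddCommGroup P] [NormedSpace ℝ P]

/-- The derivatives at `0` of `g ∘ f` up to order `k` only depend on those of `f`. -/
theorem iteratedDeriv_comp_congr {k : ℕ} {f₁ f₂ : ℝ → E} {g : E → F}
    (h₁ : ContDiffAt ℝ ∞ f₁ 0) (h₂ : ContDiffAt ℝ ∞ f₂ 0) (hg : ContDiffAt ℝ ∞ g (f₁ 0))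
    (h : ∀ i ≤ k, iteratedDeriv i f₁ 0 = iteratedDeriv i f₂ 0) :
    ∀ i ≤ k, iteratedDeriv i (g ∘ f₁) 0 = iteratedDeriv i (g ∘ f₂) 0 := by
  intro i hi
  have h0 : f₁ 0 = f₂ 0 := by simpa using h 0 (Nat.zero_le _)
  have hle : ((i : ℕ) : WithTop ℕ∞) ≤ ∞ := by exact_mod_cast le_top
  rw [iteratedDeriv_eq_iteratedFDeriv, iteratedDeriv_eq_iteratedFDeriv,
    iteratedFDeriv_comp hg h₁ hle, iteratedFDeriv_comp (h0 ▸ hg) h₂ hle, ← h0]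
  simp only [FormalMultilinearSeries.taylorComp, _root_.sum_apply]
  refine Finset.sum_congr rfl fun c _ => ?_
  simp only [FormalMultilinearSeries.compAlongOrderedFinpartition_apply]
  congr 1
  funext m
  simp only [OrderedFinpartition.applyOrderedFinpartition, ftaylorSeries,
    iteratedFDeriv_apply_eq_iteratedDeriv_mul_prod, h _ ((c.partSize_le m).trans hi)]

/-- The polynomial curve with prescribed derivatives `q 0, …, q k` at `0`. -/
def polyCurve {k : ℕ} (q : Fin (k + 1) → E) (t : ℝ) : E :=
  ∑ j : Fin (k + 1), (t ^ (j : ℕ) / ((j : ℕ).factorial : ℝ)) • q j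

theorem contDiff_polyCurve {k : ℕ} :
    ContDiff ℝ ∞ (fun x : (Fin (k + 1) → E) × ℝ => polyCurve x.1 x.2) := by
  unfold polyCurve
  fun_prop

theorem contDiff_polyCurve_right {k : ℕ} (q : Fin (k + 1) → E) : ContDiff ℝ ∞ (polyCurve q) :=
  contDiff_polyCurve.comp (contDiff_const.prodMk contDiff_id)

theorem iteratedDeriv_polyCurve {k : ℕ} (q : Fin (k + 1) → E) (i : Fin (k + 1)) :
    iteratedDeriv i (polyCurve q) 0 = q i := by
  have h1 : polyCurve q = fun t : ℝ => ∑ j : Fin (k + 1),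
      (t ^ (j : ℕ) / ((j : ℕ).factorial : ℝ)) • q j := rfl
  rw [h1, iteratedDeriv_fun_sum (fun j _ => by fun_prop)]
  rw [Finset.sum_eq_single i]
  · rw [iteratedDeriv_smul_const (by fun_prop), iteratedDeriv_div_const,
      iteratedDeriv_fun_pow_zero]
    have : ((i : ℕ).factorial : ℝ) ≠ 0 := by positivity
    simp [this]
  · intro j _ hj
    have hj' : (i : ℕ) ≠ j := fun h => hj (Fin.ext h.symm)
    rw [iteratedDeriv_smul_const (by fun_prop), iteratedDeriv_div_const,
      iteratedDeriv_fun_pow_zero]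
    simp [hj']
  · simp

theorem polyCurve_zero {k : ℕ} (q : Fin (k + 1) → E) : polyCurve q 0 = q 0 := by
  simpa using iteratedDeriv_polyCurve q 0

/-- Derivatives with respect to one variable of a smooth function are smooth. -/
theorem contDiffOn_iteratedDeriv_param {O : Set (P × ℝ)} (hO : IsOpen O) {f : P × ℝ → F}
    (hf : ContDiffOn ℝ ∞ f O) (i : ℕ) :
    ContDiffOn ℝ ∞ (fun x : P × ℝ => iteratedDeriv i (fun t => f (x.1, t)) x.2) O := by
  induction i with
  | zero => simpa using hf
  | succ i ih =>
    have h2 : ContDiffOn ℝ ∞ (fun x : P × ℝ =>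
        fderiv ℝ (fun x : P × ℝ => iteratedDeriv i (fun t => f (x.1, t)) x.2) x (0, 1)) O :=
      (ih.fderiv_of_isOpen hO (m := ∞) (by simp)).clm_apply contDiffOn_const
    refine h2.congr fun x hx => ?_
    simp only [iteratedDeriv_succ]
    have hd := ((ih x hx).contDiffAt (hO.mem_nhds hx)).differentiableAt (by simp)
    have hc : HasDerivAt (fun t : ℝ => (x.1, t)) ((0 : P), (1 : ℝ)) x.2 :=
      (hasDerivAt_const _ _).prodMk (hasDerivAt_id _)
    exact (hd.hasFDerivAt.comp_hasDerivAt x.2 hc).deriv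

end Calculus

section Jets

variable (E : Type*) [NormedAddCommGroup E] [NormedSpace ℝ E]
  (Q : Type*) [TopologicalSpace Q] [ChartedSpace E Q]

/-- Curves in `Q` which are smooth near the parameter `0`; only their germ at `0` is relevant. -/
structure SmoothCurve where
  /-- The underlying map. -/
  toFun : ℝ → Q
  contMDiffAt : ContMDiffAt 𝓘(ℝ, ℝ) 𝓘(ℝ, E) ∞ toFun 0

/-- The `k`-jet equivalence relation at `0`: the same value at `0` and, in a chart around it, the
same derivatives at `0` up to order `k`. -/
def jetSetoid (k : ℕ) : Setoid (SmoothCurve E Q) where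
  r σ τ := σ.1 0 = τ.1 0 ∧ ∀ i ≤ k, iteratedDeriv i (chartAt E (σ.1 0) ∘ σ.1) 0 =
    iteratedDeriv i (chartAt E (σ.1 0) ∘ τ.1) 0
  iseqv :=
    { refl := fun _ => ⟨rfl, fun _ _ => rfl⟩
      symm := fun {σ τ} h => ⟨h.1.symm, fun i hi => by rw [← h.1]; exact (h.2 i hi).symm⟩
      trans := fun {σ τ υ} h h' => ⟨h.1.trans h'.1, fun i hi =>
        (h.2 i hi).trans (by have := h'.2 i hi; rwa [← h.1] at this)⟩ }

/-- The `k`-th order tangent bundle `T^k Q = J^k_0(ℝ, Q)`: the `k`-jets at `0` of curves in `Q`. -/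
def HTangent (k : ℕ) : Type _ := Quotient (jetSetoid E Q k)

variable {E Q} {k : ℕ}

namespace HTangent

/-- The `k`-jet at `0` of a curve. -/
def mk (k : ℕ) (σ : SmoothCurve E Q) : HTangent E Q k := Quotient.mk (jetSetoid E Q k) σ

/-- The projection `β^k : T^k Q → Q`. -/
def pos (p : HTangent E Q k) : Q := Quotient.lift (fun σ : SmoothCurve E Q => σ.1 0)
  (fun σ τ (h : (jetSetoid E Q k).r σ τ) => h.1) p

/-- The `i`-th natural coordinate `q_i` (meaningful for `i ≤ k`) of a `k`-jet in a chart `φ` of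
`Q`: the `i`-th derivative at `0` of `φ ∘ σ`, for a curve `σ` representing the jet. -/
def coord (φ : OpenPartialHomeomorph Q E) (p : HTangent E Q k) (i : ℕ) : E :=
  iteratedDeriv i (φ ∘ (Quotient.out p).1) 0

@[simp] theorem pos_mk (σ : SmoothCurve E Q) : (mk k σ).pos = σ.1 0 := rfl

theorem mk_out (p : HTangent E Q k) : mk k (Quotient.out p) = p := Quotient.out_eq p

theorem exists_rep (p : HTangent E Q k) : ∃ σ, mk k σ = p := ⟨_, mk_out p⟩

theorem eventuallyEq_transition {φ ψ : OpenPartialHomeomorph Q E}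
    (σ : SmoothCurve E Q) (h : σ.1 0 ∈ φ.source) :
    ψ ∘ σ.1 =ᶠ[𝓝 0] (ψ ∘ φ.symm) ∘ (φ ∘ σ.1) := by
  filter_upwards [σ.2.continuousAt.preimage_mem_nhds (φ.open_source.mem_nhds h)] with t ht
  simp [φ.left_inv ht]

theorem coord_zero {φ : OpenPartialHomeomorph Q E} (p : HTangent E Q k) :
    coord φ p 0 = φ p.pos := by
  conv_rhs => rw [← mk_out p]
  simp [coord]

/-- The canonical projection `ρ^k_r : T^k Q → T^r Q`, for `r ≤ k`. -/
def rho {r k : ℕ} (h : r ≤ k) (p : HTangent E Q k) : HTangent E Q r :=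
  Quotient.map' (s₁ := jetSetoid E Q k) (s₂ := jetSetoid E Q r) id
    (fun σ τ (hr : (jetSetoid E Q k).r σ τ) => ⟨hr.1, fun i hi => hr.2 i (hi.trans h)⟩) p

theorem rho_mk {r k : ℕ} (h : r ≤ k) (σ : SmoothCurve E Q) : rho h (mk k σ) = mk r σ := rfl

theorem pos_rho {r k : ℕ} (h : r ≤ k) (p : HTangent E Q k) : (rho h p).pos = p.pos := by
  obtain ⟨σ, rfl⟩ := exists_rep p
  rfl

section Manifold

variable [IsManifold 𝓘(ℝ, E) ∞ Q]

theorem contDiffAt_chart_comp {φ : OpenPartialHomeomorph Q E} (hφ : φ ∈ atlas E Q)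
    (σ : SmoothCurve E Q) (h : σ.1 0 ∈ φ.source) : ContDiffAt ℝ ∞ (φ ∘ σ.1) 0 := by
  have h1 : ContMDiffAt 𝓘(ℝ, E) 𝓘(ℝ, E) ∞ φ (σ.1 0) :=
    contMDiffAt_of_mem_maximalAtlas (IsManifold.subset_maximalAtlas hφ) h
  exact (h1.comp 0 σ.2).contDiffAt

theorem contDiffOn_transition {φ ψ : OpenPartialHomeomorph Q E} (hφ : φ ∈ atlas E Q)
    (hψ : ψ ∈ atlas E Q) : ContDiffOn ℝ ∞ (ψ ∘ φ.symm) (φ.target ∩ φ.symm ⁻¹' ψ.source) := by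
  have h1 := contMDiffOn_symm_of_mem_maximalAtlas (I := 𝓘(ℝ, E)) (n := ∞)
    (IsManifold.subset_maximalAtlas hφ)
  have h2 := contMDiffOn_of_mem_maximalAtlas (I := 𝓘(ℝ, E)) (n := ∞)
    (IsManifold.subset_maximalAtlas hψ)
  exact (h2.comp' h1).contDiffOn

/-- If two curves through the same point have the same derivatives at `0` up to order `k` in one
chart, then they do in any other one. -/
theorem deriv_chart_congr {φ ψ : OpenPartialHomeomorph Q E} (hφ : φ ∈ atlas E Q)
    (hψ : ψ ∈ atlas E Q) {σ τ : SmoothCurve E Q} (h0 : σ.1 0 = τ.1 0) (h1 : σ.1 0 ∈ φ.source)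
    (h2 : σ.1 0 ∈ ψ.source)
    (h : ∀ i ≤ k, iteratedDeriv i (φ ∘ σ.1) 0 = iteratedDeriv i (φ ∘ τ.1) 0) :
    ∀ i ≤ k, iteratedDeriv i (ψ ∘ σ.1) 0 = iteratedDeriv i (ψ ∘ τ.1) 0 := by
  intro i hi
  rw [(eventuallyEq_transition (ψ := ψ) σ h1).iteratedDeriv_eq,
    (eventuallyEq_transition (ψ := ψ) τ (h0 ▸ h1)).iteratedDeriv_eq]
  refine iteratedDeriv_comp_congr (contDiffAt_chart_comp hφ σ h1)
    (contDiffAt_chart_comp hφ τ (h0 ▸ h1)) ?_ h i hi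
  refine (contDiffOn_transition hφ hψ).contDiffAt ?_
  have ho : IsOpen (φ.target ∩ φ.symm ⁻¹' ψ.source) :=
    φ.isOpen_inter_preimage_symm ψ.open_source
  refine ho.mem_nhds ⟨φ.map_source h1, ?_⟩
  simpa [φ.left_inv h1] using h2

theorem coord_mk {φ : OpenPartialHomeomorph Q E} (hφ : φ ∈ atlas E Q) (σ : SmoothCurve E Q)
    (h : σ.1 0 ∈ φ.source) {i : ℕ} (hi : i ≤ k) :
    coord φ (mk k σ) i = iteratedDeriv i (φ ∘ σ.1) 0 := by
  have hr : (jetSetoid E Q k).r (Quotient.out (mk k σ)) σ := Quotient.mk_out (s := jetSetoid E Q k) σ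
  have h' : (Quotient.out (mk k σ)).1 0 ∈ φ.source := by rw [hr.1]; exact h
  exact deriv_chart_congr (chart_mem_atlas E _) hφ hr.1 (mem_chart_source E _) h' hr.2 i hi

theorem mk_eq_mk {φ : OpenPartialHomeomorph Q E} (hφ : φ ∈ atlas E Q) {σ τ : SmoothCurve E Q}
    (h1 : σ.1 0 ∈ φ.source) (h2 : τ.1 0 ∈ φ.source)
    (h : ∀ i ≤ k, iteratedDeriv i (φ ∘ σ.1) 0 = iteratedDeriv i (φ ∘ τ.1) 0) :
    mk k σ = mk k τ := by
  have h0 : σ.1 0 = τ.1 0 := by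
    have := h 0 (Nat.zero_le _)
    simp only [iteratedDeriv_zero, Function.comp_apply] at this
    exact φ.injOn h1 h2 this
  exact Quotient.sound (s := jetSetoid E Q k)
    ⟨h0, deriv_chart_congr hφ (chart_mem_atlas E _) h0 h1 (mem_chart_source E _) h⟩

open Classical in
/-- The curve `φ⁻¹(q_0 + t q_1 + ⋯ + t^k/k! q_k)` in a chart `φ` (a constant curve if `q_0` is not
in the target of `φ`). -/
def chartCurve (φ : OpenPartialHomeomorph Q E) (hφ : φ ∈ atlas E Q) (q : Fin (k + 1) → E) :
    SmoothCurve E Q :=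
  if h : q 0 ∈ φ.target then
    ⟨φ.symm ∘ polyCurve q, by
      have h1 : ContMDiffAt 𝓘(ℝ, E) 𝓘(ℝ, E) ∞ φ.symm (polyCurve q 0) :=
        contMDiffAt_symm_of_mem_maximalAtlas (IsManifold.subset_maximalAtlas hφ)
          (by rwa [polyCurve_zero])
      exact h1.comp 0 (contDiff_polyCurve_right q).contDiffAt.contMDiffAt⟩
  else ⟨fun _ => φ.symm (q 0), contMDiffAt_const⟩

theorem chartCurve_val {φ : OpenPartialHomeomorph Q E} (hφ : φ ∈ atlas E Q) {q : Fin (k + 1) → E}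
    (h : q 0 ∈ φ.target) : (chartCurve φ hφ q).1 = φ.symm ∘ polyCurve q := by
  rw [chartCurve, dif_pos h]

theorem chartCurve_zero {φ : OpenPartialHomeomorph Q E} (hφ : φ ∈ atlas E Q)
    {q : Fin (k + 1) → E} (h : q 0 ∈ φ.target) : (chartCurve φ hφ q).1 0 = φ.symm (q 0) := by
  rw [chartCurve_val hφ h, Function.comp_apply, polyCurve_zero]

theorem iteratedDeriv_chartCurve {φ : OpenPartialHomeomorph Q E} (hφ : φ ∈ atlas E Q)
    {q : Fin (k + 1) → E} (h : q 0 ∈ φ.target) (i : Fin (k + 1)) :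
    iteratedDeriv i (φ ∘ (chartCurve φ hφ q).1) 0 = q i := by
  rw [← iteratedDeriv_polyCurve q i, chartCurve_val hφ h]
  refine Filter.EventuallyEq.iteratedDeriv_eq _ ?_
  have hc : ContinuousAt (polyCurve q) 0 := (contDiff_polyCurve_right q).continuous.continuousAt
  filter_upwards [hc.preimage_mem_nhds
    (φ.open_target.mem_nhds (by rwa [polyCurve_zero] : polyCurve q 0 ∈ φ.target))] with t ht
  exact φ.right_inv ht

/-- The natural chart of `T^k Q` with coordinates `(q_0, …, q_k)` induced by a chart of `Q`. -/
def jetChart (k : ℕ) (φ : OpenPartialHomeomorph Q E) (hφ : φ ∈ atlas E Q) :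
    PartialEquiv (HTangent E Q k) (Fin (k + 1) → E) where
  toFun p i := coord φ p i
  invFun q := mk k (chartCurve φ hφ q)
  source := {p | p.pos ∈ φ.source}
  target := {q | q 0 ∈ φ.target}
  map_source' p hp := by
    simp only [Set.mem_ofPred_eq, Fin.val_zero, coord_zero] at hp ⊢
    exact φ.map_source hp
  map_target' q hq := by
    simp only [Set.mem_ofPred_eq, pos_mk] at hq ⊢
    rw [chartCurve_zero hφ hq]
    exact φ.map_target hq
  left_inv' p hp := by
    obtain ⟨σ, rfl⟩ := exists_rep p
    simp only [Set.mem_ofPred_eq, pos_mk] at hp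
    have h0 : coord φ (mk k σ) ((0 : Fin (k + 1)) : ℕ) ∈ φ.target := by
      simp only [Fin.val_zero, coord_zero, pos_mk]
      exact φ.map_source hp
    refine mk_eq_mk hφ ?_ hp fun i hi => ?_
    · rw [chartCurve_zero hφ (by exact h0)]
      exact φ.map_target h0
    · have := iteratedDeriv_chartCurve hφ (q := fun i : Fin (k + 1) => coord φ (mk k σ) i) h0
        ⟨i, Nat.lt_succ_of_le hi⟩
      simp only at this
      rw [this, coord_mk hφ σ hp hi]
  right_inv' q hq := by
    simp only [Set.mem_ofPred_eq] at hq
    funext i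
    rw [coord_mk hφ _ (by rw [chartCurve_zero hφ hq]; exact φ.map_target hq)
      (Nat.le_of_lt_succ i.2), iteratedDeriv_chartCurve hφ hq]

theorem trans_source {φ ψ : OpenPartialHomeomorph Q E} (hφ : φ ∈ atlas E Q) (hψ : ψ ∈ atlas E Q) :
    ((jetChart k φ hφ).symm.trans (jetChart k ψ hψ)).source =
      (fun q => q 0) ⁻¹' (φ.target ∩ φ.symm ⁻¹' ψ.source) := by
  ext q
  simp only [PartialEquiv.trans_source, PartialEquiv.symm_source, jetChart, Set.mem_inter_iff,
    Set.mem_ofPred_eq, Set.mem_preimage, PartialEquiv.coe_symm_mk, pos_mk]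
  refine and_congr_right fun h => ?_
  rw [chartCurve_zero hφ h]

theorem isOpen_trans_source {φ ψ : OpenPartialHomeomorph Q E} (hφ : φ ∈ atlas E Q)
    (hψ : ψ ∈ atlas E Q) :
    IsOpen ((jetChart k φ hφ).symm.trans (jetChart k ψ hψ)).source := by
  rw [trans_source]
  exact (φ.isOpen_inter_preimage_symm ψ.open_source).preimage (continuous_apply 0)

theorem contDiffOn_trans {φ ψ : OpenPartialHomeomorph Q E} (hφ : φ ∈ atlas E Q)
    (hψ : ψ ∈ atlas E Q) :
    ContDiffOn ℝ ∞ ((jetChart k φ hφ).symm.trans (jetChart k ψ hψ))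
      ((jetChart k φ hφ).symm.trans (jetChart k ψ hψ)).source := by
  rw [contDiffOn_pi]
  intro i
  have hO : IsOpen (φ.target ∩ φ.symm ⁻¹' ψ.source) := φ.isOpen_inter_preimage_symm ψ.open_source
  have hO' : IsOpen ((fun x : (Fin (k + 1) → E) × ℝ => polyCurve x.1 x.2) ⁻¹'
      (φ.target ∩ φ.symm ⁻¹' ψ.source)) := hO.preimage contDiff_polyCurve.continuous
  have h1 := contDiffOn_iteratedDeriv_param hO'
    ((contDiffOn_transition hφ hψ).comp contDiff_polyCurve.contDiffOn (Set.mapsTo_preimage _ _)) i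
  have h2 : ContDiffOn ℝ ∞ (fun q : Fin (k + 1) → E => (q, (0 : ℝ)))
      ((jetChart k φ hφ).symm.trans (jetChart k ψ hψ)).source :=
    contDiffOn_id.prodMk contDiffOn_const
  refine (h1.comp h2 ?_).congr ?_
  · intro q hq
    rw [trans_source] at hq
    simpa [polyCurve_zero] using hq
  · intro q hq
    rw [trans_source] at hq
    have h3 : (chartCurve φ hφ q).1 0 ∈ ψ.source := by
      rw [chartCurve_zero hφ hq.1]; exact hq.2
    simp only [jetChart, PartialEquiv.coe_trans, PartialEquiv.coe_symm_mk,
      Function.comp_apply]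
    rw [coord_mk hψ _ h3 (Nat.le_of_lt_succ i.2), chartCurve_val hφ hq.1]
    rfl

variable (E Q) in
/-- The natural atlas of `T^k Q`. -/
def core (k : ℕ) : ChartedSpaceCore (Fin (k + 1) → E) (HTangent E Q k) where
  atlas := {e | ∃ (φ : OpenPartialHomeomorph Q E) (hφ : φ ∈ atlas E Q), e = jetChart k φ hφ}
  chartAt p := jetChart k (chartAt E p.pos) (chart_mem_atlas E p.pos)
  mem_chart_source p := mem_chart_source E p.pos
  chart_mem_atlas p := ⟨_, _, rfl⟩
  open_source := by
    rintro _ _ ⟨φ, hφ, rfl⟩ ⟨ψ, hψ, rfl⟩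
    exact isOpen_trans_source hφ hψ
  continuousOn_toFun := by
    rintro _ _ ⟨φ, hφ, rfl⟩ ⟨ψ, hψ, rfl⟩
    exact (contDiffOn_trans hφ hψ).continuousOn

instance : TopologicalSpace (HTangent E Q k) := (core E Q k).toTopologicalSpace

instance : ChartedSpace (Fin (k + 1) → E) (HTangent E Q k) := (core E Q k).toChartedSpace

instance : IsManifold 𝓘(ℝ, Fin (k + 1) → E) ∞ (HTangent E Q k) := by
  refine isManifold_of_contDiffOn _ _ _ ?_
  intro e e' he he'
  obtain ⟨_, ⟨f, rfl⟩, h1⟩ := he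
  obtain ⟨_, ⟨⟨φ, hφ, rfl⟩, rfl⟩, rfl⟩ := h1
  obtain ⟨_, ⟨f', rfl⟩, h1'⟩ := he'
  obtain ⟨_, ⟨⟨ψ, hψ, rfl⟩, rfl⟩, rfl⟩ := h1'
  refine (contDiffOn_trans hφ hψ).mono ?_
  exact Set.inter_subset_left

theorem coord_rho {r k : ℕ} (h : r ≤ k) {φ : OpenPartialHomeomorph Q E} (hφ : φ ∈ atlas E Q)
    (p : HTangent E Q k) (hp : p.pos ∈ φ.source) {i : ℕ} (hi : i ≤ r) :
    coord φ (rho h p) i = coord φ p i := by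
  obtain ⟨σ, rfl⟩ := exists_rep p
  rw [rho_mk, coord_mk hφ σ hp hi, coord_mk hφ σ hp (hi.trans h)]

theorem contMDiff_rho {r k : ℕ} (h : r ≤ k) :
    ContMDiff 𝓘(ℝ, Fin (k + 1) → E) 𝓘(ℝ, Fin (r + 1) → E) ∞
      (rho h : HTangent E Q k → HTangent E Q r) := by
  intro p
  let e := chartAt (Fin (k + 1) → E) p
  let e' := chartAt (Fin (r + 1) → E) (rho h p)
  let T : (Fin (k + 1) → E) → (Fin (r + 1) → E) := fun q i => q (Fin.castLE (by omega) i)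
  have hT : ContDiff ℝ ∞ T := by unfold T; fun_prop
  have key : ∀ p' ∈ e.source, T (e p') = e' (rho h p') ∧ rho h p' ∈ e'.source := by
    intro p' hp'
    have hs : p'.pos ∈ (chartAt E p.pos).source := hp'
    constructor
    · funext i
      change coord (chartAt E p.pos) p' i = coord (chartAt E (rho h p).pos) (rho h p') i
      rw [pos_rho, coord_rho h (chart_mem_atlas E _) p' hs (Nat.le_of_lt_succ i.2)]
    · change (rho h p').pos ∈ (chartAt E (rho h p).pos).source
      rwa [pos_rho, pos_rho]
  have h1 : rho h =ᶠ[𝓝 p] e'.symm ∘ T ∘ e := by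
    filter_upwards [e.open_source.mem_nhds (mem_chart_source _ p)] with p' hp'
    simp only [Function.comp_apply]
    rw [(key p' hp').1, e'.left_inv (key p' hp').2]
  refine ContMDiffAt.congr_of_eventuallyEq ?_ h1
  have hp := key p (mem_chart_source _ p)
  have h2 : ContMDiffAt 𝓘(ℝ, Fin (r + 1) → E) 𝓘(ℝ, Fin (r + 1) → E) ∞ e'.symm (T (e p)) := by
    rw [hp.1]
    exact contMDiffAt_symm_of_mem_maximalAtlas (IsManifold.chart_mem_maximalAtlas _)
      (e'.map_source hp.2)
  have h3 : ContMDiffAt 𝓘(ℝ, Fin (k + 1) → E) 𝓘(ℝ, Fin (k + 1) → E) ∞ e p :=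
    contMDiffAt_of_mem_maximalAtlas (IsManifold.chart_mem_maximalAtlas _) (mem_chart_source _ p)
  exact h2.comp p (hT.contDiffAt.contMDiffAt.comp p h3)

variable (E Q) in
/-- The canonical projection `ρ^k_r : T^k Q → T^r Q`, for `r ≤ k`, as a smooth map. -/
def rhoMap {r k : ℕ} (h : r ≤ k) : ContMDiffMap 𝓘(ℝ, Fin (k + 1) → E) 𝓘(ℝ, Fin (r + 1) → E)
    (HTangent E Q k) (HTangent E Q r) ∞ := ⟨rho h, contMDiff_rho h⟩

/-- The tangent map `Tρ^k_r`. -/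
def Trho {r k : ℕ} (h : r ≤ k) (p : HTangent E Q k) :
    TangentSpace 𝓘(ℝ, Fin (k + 1) → E) p →L[ℝ] TangentSpace 𝓘(ℝ, Fin (r + 1) → E) (rho h p) :=
  mfderiv 𝓘(ℝ, Fin (k + 1) → E) 𝓘(ℝ, Fin (r + 1) → E) (rho h) p

/-- The canonical injection `j_{r+1} : T^k Q → T(T^r Q)`, for `r < k`, which maps `p` to a vector
tangent at `ρ^k_r(p)`, with natural coordinates `(q_1, …, q_{r+1})`. -/
def inj {r k : ℕ} (h : r < k) (p : HTangent E Q k) :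
    TangentSpace 𝓘(ℝ, Fin (r + 1) → E) (rho h.le p) :=
  (fun i => coord (chartAt E p.pos) p (i + 1) : Fin (r + 1) → E)

/-- The `r`-th vertical endomorphism `J_r` of `T(T^k Q)`: in natural coordinates,
`(v_0, …, v_k) ↦ (0, …, 0, r! v_0, …, k!/(k-r)! v_{k-r})`. -/
def vertEndo (r : ℕ) (p : HTangent E Q k) :
    TangentSpace 𝓘(ℝ, Fin (k + 1) → E) p →L[ℝ] TangentSpace 𝓘(ℝ, Fin (k + 1) → E) p :=
  (ContinuousLinearMap.pi fun i : Fin (k + 1) => ((i : ℕ).descFactorial r : ℝ) •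
    ContinuousLinearMap.proj (R := ℝ) (φ := fun _ : Fin (k + 1) => E)
      ⟨(i : ℕ) - r, (Nat.sub_le _ _).trans_lt i.2⟩ : (Fin (k + 1) → E) →L[ℝ] (Fin (k + 1) → E))

/-- The `r`-th canonical vector field `Δ_r` (`1 ≤ r`) on `T^k Q`: in natural coordinates
`(0, …, 0, r! q_1, …, k!/(k-r)! q_{k-r+1})`. -/
def canonicalField (r : ℕ) (p : HTangent E Q k) : TangentSpace 𝓘(ℝ, Fin (k + 1) → E) p :=
  (fun i : Fin (k + 1) => ((i : ℕ).descFactorial r : ℝ) •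
    coord (chartAt E p.pos) p ((i : ℕ) - r + 1) : Fin (k + 1) → E)

end Manifold
end HTangent
end Jets

section Forms

/-- Differential `1`-forms (not necessarily smooth) on a manifold. -/
abbrev OneForm {F H : Type*} [NormedAddCommGroup F] [NormedSpace ℝ F] [TopologicalSpace H]
    (I : ModelWithCorners ℝ F H) (M : Type*) [TopologicalSpace M] [ChartedSpace H M] : Type _ :=
  (x : M) → TangentSpace I x →L[ℝ] ℝ

variable {F H : Type*} [NormedAddCommGroup F] [NormedSpace ℝ F] [TopologicalSpace H]
  {I : ModelWithCorners ℝ F H} {M : Type*} [TopologicalSpace M] [ChartedSpace H M]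

/-- The exterior derivative of a `1`-form on a manifold without boundary,
`dθ(u, v) = D_u θ (v) - D_v θ (u)`, computed at `x` in the preferred chart at `x`
(`TangentSpace I x` is the model space `F`, through that same chart). -/
def extDerivForm (θ : OneForm I M) (x : M) : TangentSpace I x →L[ℝ] TangentSpace I x →L[ℝ] ℝ :=
  let η : F → F →L[ℝ] ℝ := fun y =>
    (θ ((extChartAt I x).symm y)).comp (mfderiv 𝓘(ℝ, F) I (extChartAt I x).symm y)
  let D : F →L[ℝ] F →L[ℝ] ℝ := fderiv ℝ η (extChartAt I x x)
  (D - D.flip : F →L[ℝ] F →L[ℝ] ℝ)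

/-- The differential of a function, as a `1`-form. -/
def dFun (f : M → ℝ) : OneForm I M := fun x => mfderiv I 𝓘(ℝ, ℝ) f x

end Forms

section Cotangent

variable (F : Type*) [NormedAddCommGroup F] [NormedSpace ℝ F]
  (M : Type*) [TopologicalSpace M] [ChartedSpace F M]

/-- The cotangent space `T*_x M`. -/
abbrev CotangentSpace {M : Type*} [TopologicalSpace M] [ChartedSpace F M] (x : M) : Type _ :=
  TangentSpace 𝓘(ℝ, F) x →L[ℝ] ℝ

variable [IsManifold 𝓘(ℝ, F) ∞ M]
/-- The cotangent bundle `T*M`. -/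
abbrev CotangentBundle : Type _ := TotalSpace (F →L[ℝ] ℝ) (fun x : M => CotangentSpace F x)

/-- The model of the cotangent bundle. -/
abbrev cotangentModel := (𝓘(ℝ, F)).prod 𝓘(ℝ, F →L[ℝ] ℝ)

/-- The canonical (Liouville) `1`-form of `T*M`: `θ_α(v) = α(Tπ(v))`. -/
def liouvilleForm : OneForm (cotangentModel F) (CotangentBundle F M) := fun a =>
  a.2.comp (mfderiv (cotangentModel F) 𝓘(ℝ, F)
    (TotalSpace.proj : CotangentBundle F M → M) a)

/-- The canonical symplectic form `ω = -dθ` of `T*M`. -/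
def canonicalTwoForm (a : CotangentBundle F M) :
    TangentSpace (cotangentModel F) a →L[ℝ] TangentSpace (cotangentModel F) a →L[ℝ] ℝ :=
  -extDerivForm (liouvilleForm F M) a
end Cotangent

section Lagrangian

variable {E : Type*} [NormedAddCommGroup E] [NormedSpace ℝ E]
  {Q : Type*} [TopologicalSpace Q] [ChartedSpace E Q] [IsManifold 𝓘(ℝ, E) ∞ Q] {m : ℕ}

open HTangent

/-- `1`-forms on `T^m Q`. -/
abbrev JetForm (E : Type*) [NormedAddCommGroup E] [NormedSpace ℝ E]
    (Q : Type*) [TopologicalSpace Q] [ChartedSpace E Q] [IsManifold 𝓘(ℝ, E) ∞ Q] (m : ℕ) :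
    Type _ := OneForm 𝓘(ℝ, Fin (m + 1) → E) (HTangent E Q m)

/-- The pull-back of a `1`-form by `ρ^k_r`. -/
def pullRho {r k : ℕ} (h : r ≤ k) (α : JetForm E Q r) : JetForm E Q k := fun p =>
  (α (rho h p)).comp (Trho h p)

/-- Tulczyjew's derivation on functions: `(d_T f)(p) = d f (j_{m+1}(p))`. -/
def tulczyjewFun (f : HTangent E Q m → ℝ) (p : HTangent E Q (m + 1)) : ℝ :=
  dFun (I := 𝓘(ℝ, Fin (m + 1) → E)) f (rho (Nat.le_succ m) p) (inj (Nat.lt_succ_self m) p)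

/-- Tulczyjew's derivation on `1`-forms, given by Cartan's formula `d_T = i_T d + d i_T` along
`j_{m+1} : T^{m+1} Q → T(T^m Q)`. It is the derivation commuting with `d` which extends
`tulczyjewFun`; in natural coordinates, `d_T(a dq_i) = (d_T a) dq_i + a dq_{i+1}`. -/
def tulczyjewForm (α : JetForm E Q m) : JetForm E Q (m + 1) := fun p =>
  (extDerivForm α (rho (Nat.le_succ m) p) (inj (Nat.lt_succ_self m) p)).comp
      (Trho (Nat.le_succ m) p) +
    dFun (fun p' : HTangent E Q (m + 1) =>
      α (rho (Nat.le_succ m) p') (inj (Nat.lt_succ_self m) p')) p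

/-- `d_T^s` on functions. -/
def tulczyjewFunIter (f : HTangent E Q m → ℝ) : (s : ℕ) → HTangent E Q (m + s) → ℝ
  | 0 => f
  | s + 1 => tulczyjewFun (tulczyjewFunIter f s)

/-- `d_T^s` on `1`-forms. -/
def tulczyjewFormIter (α : JetForm E Q m) : (s : ℕ) → JetForm E Q (m + s)
  | 0 => α
  | s + 1 => tulczyjewForm (tulczyjewFormIter α s)

variable {k : ℕ}

/-- The `1`-form `d_{J_r} L = i(J_r) dL = dL ∘ J_r`. -/
def vertDiff (r : ℕ) (L : HTangent E Q k → ℝ) : JetForm E Q k := fun p =>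
  (dFun L p).comp (vertEndo r p)

/-- The Lagrangian `1`-form on `T^{2k-1} Q`:
`θ_L = ∑_{r=1}^k (-1)^{r-1} (1/r!) d_T^{r-1} d_{J_r} L` (with `r = s + 1`). -/
def lagrangianForm (L : HTangent E Q k → ℝ) : JetForm E Q (2 * k - 1) := fun p =>
  ∑ s : Fin k, ((-1 : ℝ) ^ (s : ℕ) / (((s : ℕ) + 1).factorial : ℝ)) •
    pullRho (by omega : k + (s : ℕ) ≤ 2 * k - 1)
      (tulczyjewFormIter (vertDiff ((s : ℕ) + 1) L) (s : ℕ)) p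

/-- The Lagrangian `2`-form `ω_L = -dθ_L`. -/
def lagrangianTwoForm (L : HTangent E Q k → ℝ) (p : HTangent E Q (2 * k - 1)) :
    TangentSpace 𝓘(ℝ, Fin (2 * k - 1 + 1) → E) p →L[ℝ]
      TangentSpace 𝓘(ℝ, Fin (2 * k - 1 + 1) → E) p →L[ℝ] ℝ :=
  -extDerivForm (lagrangianForm L) p

/-- The Lagrangian energy on `T^{2k-1} Q`:
`E_L = ∑_{r=1}^k (-1)^{r-1} (1/r!) d_T^{r-1}(Δ_r(L)) - L` (with `r = s + 1`). -/
def lagrangianEnergy (hk : 1 ≤ k) (L : HTangent E Q k → ℝ) (p : HTangent E Q (2 * k - 1)) : ℝ :=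
  ∑ s : Fin k, ((-1 : ℝ) ^ (s : ℕ) / (((s : ℕ) + 1).factorial : ℝ)) *
    tulczyjewFunIter (fun p' => dFun (I := 𝓘(ℝ, Fin (k + 1) → E)) L p'
      (canonicalField ((s : ℕ) + 1) p')) (s : ℕ)
      (rho (by omega : k + (s : ℕ) ≤ 2 * k - 1) p)
  - L (rho (by omega : k ≤ 2 * k - 1) p)

open Classical in
/-- The fibre part of the Legendre-Ostrogradsky map `FL : T^{2k-1} Q → T*(T^{k-1} Q)`: the covector
`FL(p)` at `ρ^{2k-1}_{k-1}(p)` such that `θ_L(u) = ⟨FL(p), Tρ^{2k-1}_{k-1}(u)⟩` for every `u`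
tangent at `p`. For smooth `L` such a covector exists because `θ_L` is semibasic, and it is unique
because `ρ^{2k-1}_{k-1}` is a submersion. -/
def legendre (L : HTangent E Q k → ℝ) (p : HTangent E Q (2 * k - 1)) :
    CotangentSpace (Fin (k - 1 + 1) → E) (rho (by omega : k - 1 ≤ 2 * k - 1) p) :=
  if h : ∃ α : CotangentSpace (Fin (k - 1 + 1) → E) (rho (by omega : k - 1 ≤ 2 * k - 1) p),
      ∀ u, lagrangianForm L p u = α (Trho (by omega : k - 1 ≤ 2 * k - 1) p u)
  then h.choose else 0

end Lagrangian

section Unified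

open HTangent

variable (E : Type*) [NormedAddCommGroup E] [NormedSpace ℝ E]
  (Q : Type*) [TopologicalSpace Q] [ChartedSpace E Q] [IsManifold 𝓘(ℝ, E) ∞ Q] (k : ℕ)

/-- The unified phase space `W = T^{2k-1} Q ×_{T^{k-1} Q} T*(T^{k-1} Q)`: the pull-back of the
cotangent bundle of `T^{k-1} Q` by `ρ^{2k-1}_{k-1}`. Its points are the pairs `(p, α)` with
`p ∈ T^{2k-1} Q` and `α` a covector at `ρ^{2k-1}_{k-1}(p)`. -/
abbrev UnifiedSpace : Type _ :=
  TotalSpace ((Fin (k - 1 + 1) → E) →L[ℝ] ℝ)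
    (rhoMap E Q (by omega : k - 1 ≤ 2 * k - 1) *ᵖ
      (fun x : HTangent E Q (k - 1) => CotangentSpace (Fin (k - 1 + 1) → E) x))

/-- The model of the unified phase space. -/
abbrev unifiedModel :=
  (𝓘(ℝ, Fin (2 * k - 1 + 1) → E)).prod 𝓘(ℝ, (Fin (k - 1 + 1) → E) →L[ℝ] ℝ)

variable {E Q k}

/-- The projection `pr₁ : W → T^{2k-1} Q`. -/
def pr1 (w : UnifiedSpace E Q k) : HTangent E Q (2 * k - 1) := w.proj

/-- The projection `pr₂ : W → T*(T^{k-1} Q)`. -/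
def pr2 (w : UnifiedSpace E Q k) :
    CotangentBundle (Fin (k - 1 + 1) → E) (HTangent E Q (k - 1)) :=
  ⟨rho (by omega : k - 1 ≤ 2 * k - 1) w.proj, w.2⟩

/-- The tangent map of `pr₁`. -/
def Tpr1 (w : UnifiedSpace E Q k) :
    TangentSpace (unifiedModel E k) w →L[ℝ] TangentSpace 𝓘(ℝ, Fin (2 * k - 1 + 1) → E) (pr1 w) :=
  mfderiv (unifiedModel E k) 𝓘(ℝ, Fin (2 * k - 1 + 1) → E) pr1 w

/-- The tangent map of `pr₂`. -/
def Tpr2 (w : UnifiedSpace E Q k) :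
    TangentSpace (unifiedModel E k) w →L[ℝ]
      TangentSpace (cotangentModel (Fin (k - 1 + 1) → E)) (pr2 w) :=
  mfderiv (unifiedModel E k) (cotangentModel (Fin (k - 1 + 1) → E)) pr2 w

/-- The presymplectic form `Ω = pr₂* ω_{k-1}` of `W`. -/
def unifiedTwoForm (w : UnifiedSpace E Q k) (u v : TangentSpace (unifiedModel E k) w) : ℝ :=
  canonicalTwoForm (Fin (k - 1 + 1) → E) (HTangent E Q (k - 1)) (pr2 w) (Tpr2 w u) (Tpr2 w v)

/-- The coupling function `C(p, α) = ⟨α, j_k(p)⟩`. -/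
def coupling (hk : 1 ≤ k) (w : UnifiedSpace E Q k) : ℝ :=
  (pr2 w).2 (inj (by omega : k - 1 < 2 * k - 1) (pr1 w))

/-- The Hamiltonian function `H = C - (ρ^{2k-1}_k ∘ pr₁)* L` of `W`. -/
def hamiltonian (hk : 1 ≤ k) (L : HTangent E Q k → ℝ) (w : UnifiedSpace E Q k) : ℝ :=
  coupling hk w - L (rho (by omega : k ≤ 2 * k - 1) (pr1 w))

/-- The graph map `p ↦ (p, FL(p))` of the Legendre-Ostrogradsky map. -/
def graphMap (L : HTangent E Q k → ℝ) (p : HTangent E Q (2 * k - 1)) : UnifiedSpace E Q k :=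
  ⟨p, legendre L p⟩

/-- The submanifold `W_o = graph FL` of `W`. -/
def graphSet (L : HTangent E Q k → ℝ) : Set (UnifiedSpace E Q k) := Set.range (graphMap L)

/-- `X` is a smooth vector field of `W` at support on a subset `S` (here `S = W_o`); the values of
`X` outside of `S` are irrelevant. -/
def IsFieldOn (S : Set (UnifiedSpace E Q k))
    (X : (w : UnifiedSpace E Q k) → TangentSpace (unifiedModel E k) w) : Prop :=
  ContMDiffOn (unifiedModel E k) (unifiedModel E k).tangent ∞
    (fun w => (⟨w, X w⟩ : TangentBundle (unifiedModel E k) (UnifiedSpace E Q k))) S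

/-- `X` is tangent to `W_o`: at each of its points `(p, FL(p))`, it takes its value in the tangent
space of `W_o`, the image of the tangent map at `p` of the graph parametrization. -/
def IsTangentToGraph (L : HTangent E Q k → ℝ)
    (X : (w : UnifiedSpace E Q k) → TangentSpace (unifiedModel E k) w) : Prop :=
  ∀ p, X (graphMap L p) ∈ Set.range
    (mfderiv 𝓘(ℝ, Fin (2 * k - 1 + 1) → E) (unifiedModel E k) (graphMap L) p)

/-- `X` solves the dynamical equation `i(X)Ω - dH = 0` at the points of `W_o`. -/
def IsUnifiedSolution (hk : 1 ≤ k) (L : HTangent E Q k → ℝ)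
    (X : (w : UnifiedSpace E Q k) → TangentSpace (unifiedModel E k) w) : Prop :=
  ∀ w ∈ graphSet L, ∀ v : TangentSpace (unifiedModel E k) w,
    unifiedTwoForm w (X w) v = dFun (hamiltonian hk L) w v

/-- `X_L` is the (smooth) vector field on `T^{2k-1} Q` associated with `X`:
`X_L ∘ pr₁ ∘ j_o = Tpr₁ ∘ X ∘ j_o`, where `j_o : W_o → W` is the inclusion. -/
def IsAssociatedField (L : HTangent E Q k → ℝ)
    (X : (w : UnifiedSpace E Q k) → TangentSpace (unifiedModel E k) w)
    (XL : (p : HTangent E Q (2 * k - 1)) → TangentSpace 𝓘(ℝ, Fin (2 * k - 1 + 1) → E) p) : Prop :=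
  ContMDiff 𝓘(ℝ, Fin (2 * k - 1 + 1) → E) (𝓘(ℝ, Fin (2 * k - 1 + 1) → E)).tangent ∞
    (fun p => (⟨p, XL p⟩ : TangentBundle 𝓘(ℝ, Fin (2 * k - 1 + 1) → E)
      (HTangent E Q (2 * k - 1)))) ∧
  ∀ w ∈ graphSet L, XL (pr1 w) = Tpr1 w (X w)

/-- `X_L` is a Lagrangian vector field: `i(X_L)ω_L = dE_L` on `T^{2k-1} Q`. -/
def IsLagrangianField (hk : 1 ≤ k) (L : HTangent E Q k → ℝ)
    (XL : (p : HTangent E Q (2 * k - 1)) → TangentSpace 𝓘(ℝ, Fin (2 * k - 1 + 1) → E) p) : Prop :=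
  ∀ p, lagrangianTwoForm L p (XL p) = dFun (lagrangianEnergy hk L) p

end Unified

end HigherOrder

end

open HigherOrder

open scoped Manifold ContDiff Topology
open Bundle

noncomputable section

namespace HigherOrder

/-! ### Derivatives along a curve of jets -/

section Calculus

variable {E F : Type*} [NormedAddCommGroup E] [NormedSpace ℝ E]
  [NormedAddCommGroup F] [NormedSpace ℝ F]

/-! Let γ be the graph map p ↦ (p, FL(p)), a smooth section of pr₁ with image `graphSet L`. The
proof rests on two identities, γ*Ω = ω_L and γ*H = E_L. Tangency gives X(γ(p)) = Tγ(u) for some u,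
and applying Tpr₁ shows u = X_L(p). Testing the unified equation on the vectors Tγ(v) alone then
gives ω_L(X_L, v) = dE_L(v). Since every point of the graph is a γ(p), the only candidate for X_L is
Tpr₁ ∘ X ∘ γ, which is smooth because γ is. Integral curves project by the chain rule.

The identity γ*Ω = ω_L (`lagrangianTwoForm_eq_pullback`) holds because the defining property of FL
says that θ_L is the pull-back of the Liouville form by pr₂ ∘ γ, and the exterior derivative
commutes with pull-backs (`extDerivForm_pullback`). That FL exists is a count of orders: d_{J_r}L
involves only dq_0, …, dq_{k-r}, and each d_T raises the top index by one, so every term of θ_L is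
semibasic over T^{k-1}Q (`isSemibasic_lagrangianForm`).

For γ*H = E_L (`hamiltonian_graphMap`), lift p to T^{2k}Q. The lift gives a vector T at p which
projects to j_k(p), so ⟨FL(p), j_k(p)⟩ = θ_L(T). Contraction with T commutes with d_T, by Cartan's
formula and dα(T, T) = 0, and it sends d_{J_r}L to dL(J_r T) = Δ_r(L). Summing, θ_L(T) = E_L + L.

The canonical objects are defined pointwise in the preferred chart at each point. Smoothness and
local formulas need one fixed natural chart near a point, so T, J_r and Tρ are first expressed in
the frame `jetFrame` of an arbitrary natural chart. -/

theorem natCast_le_infty (n : ℕ) : (n : WithTop ℕ∞) ≤ ∞ := by exact_mod_cast le_top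

theorem iteratedDeriv_prodMk {n : ℕ} {f : ℝ → E} {g : ℝ → F} {x : ℝ}
    (hf : ContDiffAt ℝ ∞ f x) (hg : ContDiffAt ℝ ∞ g x) :
    iteratedDeriv n (fun t => (f t, g t)) x = (iteratedDeriv n f x, iteratedDeriv n g x) := by
  simp only [iteratedDeriv]
  rw [iteratedFDeriv_prodMk hf hg (natCast_le_infty n)]
  rfl

/-- The derivatives at `0` of `t ^ r • w`. -/
theorem iteratedDeriv_pow_smul_zero {r : ℕ} {w : ℝ → E} (hw : ContDiffAt ℝ ∞ w 0) (i : ℕ) :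
    iteratedDeriv i (fun t : ℝ => t ^ r • w t) 0 =
      (i.descFactorial r : ℝ) • iteratedDeriv (i - r) w 0 := by
  have h := iteratedDerivWithin_smul (n := i) (s := Set.univ) (x := (0 : ℝ)) (Set.mem_univ _)
    uniqueDiffOn_univ (f := fun t : ℝ => t ^ r) (g := w) (by fun_prop)
    ((hw.of_le (natCast_le_infty i)).contDiffWithinAt)
  simp only [iteratedDerivWithin_univ] at h
  change iteratedDeriv i ((fun t : ℝ => t ^ r) • w) 0 = _
  rw [h]
  simp only [iteratedDeriv_fun_pow_zero]
  -- Among the derivatives of t^r at 0 only the r-th is nonzero, with value r!. One Leibniz term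
  -- survives, with coefficient C(i, r) r!; for i < r none does, and the descending factorial is 0
  -- as well.
  by_cases hi : r ≤ i
  · rw [Finset.sum_eq_single r]
    · rw [if_pos rfl, Nat.descFactorial_eq_factorial_mul_choose, ← Nat.cast_smul_eq_nsmul ℝ,
        smul_smul, Nat.cast_mul, mul_comm]
    · intro j _ hj
      simp [hj]
    · intro hr
      exact absurd (Finset.mem_range.2 (Nat.lt_succ_of_le hi)) hr
  · rw [Finset.sum_eq_zero, Nat.descFactorial_of_lt (not_le.1 hi)]
    · simp
    · intro j hj
      have : j ≠ r := by
        have := Finset.mem_range.1 hj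
        omega
      simp [this]

/-- The partial derivatives of a smooth function commute. -/
theorem deriv_deriv_comm {O : Set (ℝ × ℝ)} (hO : IsOpen O) {f : ℝ × ℝ → F}
    (hf : ContDiffOn ℝ ∞ f O) {x : ℝ × ℝ} (hx : x ∈ O) :
    deriv (fun s => deriv (fun t => f (s, t)) x.2) x.1 =
      deriv (fun t => deriv (fun s => f (s, t)) x.1) x.2 := by
  have hd : ∀ y ∈ O, DifferentiableAt ℝ f y := fun y hy =>
    ((hf y hy).contDiffAt (hO.mem_nhds hy)).differentiableAt (by simp)
  have h2 : DifferentiableAt ℝ (fderiv ℝ f) x :=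
    (((hf.fderiv_of_isOpen hO (m := ∞) (by simp)) x hx).contDiffAt
      (hO.mem_nhds hx)).differentiableAt (by simp)
  have c1 : ∀ y : ℝ × ℝ, HasDerivAt (fun s : ℝ => (s, y.2)) ((1 : ℝ), (0 : ℝ)) y.1 := fun y =>
    (hasDerivAt_id _).prodMk (hasDerivAt_const _ _)
  have c2 : ∀ y : ℝ × ℝ, HasDerivAt (fun t : ℝ => (y.1, t)) ((0 : ℝ), (1 : ℝ)) y.2 := fun y =>
    (hasDerivAt_const _ _).prodMk (hasDerivAt_id _)
  have d1 : ∀ y ∈ O, deriv (fun s => f (s, y.2)) y.1 = fderiv ℝ f y (1, 0) := fun y hy =>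
    ((hd y hy).hasFDerivAt.comp_hasDerivAt y.1 (c1 y)).deriv
  have d2 : ∀ y ∈ O, deriv (fun t => f (y.1, t)) y.2 = fderiv ℝ f y (0, 1) := fun y hy =>
    ((hd y hy).hasFDerivAt.comp_hasDerivAt y.2 (c2 y)).deriv
  have e1 : (fun s => deriv (fun t => f (s, t)) x.2) =ᶠ[𝓝 x.1]
      fun s => fderiv ℝ f (s, x.2) (0, 1) := by
    filter_upwards [(c1 x).continuousAt.preimage_mem_nhds (hO.mem_nhds hx)] with s hs
    exact d2 (s, x.2) hs
  have e2 : (fun t => deriv (fun s => f (s, t)) x.1) =ᶠ[𝓝 x.2]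
      fun t => fderiv ℝ f (x.1, t) (1, 0) := by
    filter_upwards [(c2 x).continuousAt.preimage_mem_nhds (hO.mem_nhds hx)] with t ht
    exact d1 (x.1, t) ht
  rw [e1.deriv_eq, e2.deriv_eq]
  have g1 : HasDerivAt (fun s => fderiv ℝ f (s, x.2)) (fderiv ℝ (fderiv ℝ f) x (1, 0)) x.1 :=
    h2.hasFDerivAt.comp_hasDerivAt x.1 (c1 x)
  have g2 : HasDerivAt (fun t => fderiv ℝ f (x.1, t)) (fderiv ℝ (fderiv ℝ f) x (0, 1)) x.2 :=
    h2.hasFDerivAt.comp_hasDerivAt x.2 (c2 x)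
  rw [(g1.clm_apply (hasDerivAt_const _ _)).deriv, (g2.clm_apply (hasDerivAt_const _ _)).deriv]
  simp only [map_zero, add_zero]
  exact (((hf x hx).contDiffAt (hO.mem_nhds hx)).isSymmSndFDerivAt
    (by simpa using natCast_le_infty 2)).eq _ _

/-- Each inductive step moves the s-derivative past one more t-derivative. It is stated on all of O
because the induction hypothesis is differentiated in t, hence is needed near the point. -/
theorem deriv_iteratedDeriv_comm {O : Set (ℝ × ℝ)} (hO : IsOpen O) {f : ℝ × ℝ → F}
    (hf : ContDiffOn ℝ ∞ f O) (i : ℕ) : ∀ x ∈ O,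
    deriv (fun s => iteratedDeriv i (fun t => f (s, t)) x.2) x.1 =
      iteratedDeriv i (fun t => deriv (fun s => f (s, t)) x.1) x.2 := by
  induction i with
  | zero => simp
  | succ i ih =>
    intro x hx
    simp only [iteratedDeriv_succ]
    rw [deriv_deriv_comm hO (contDiffOn_iteratedDeriv_param hO hf i) hx]
    refine Filter.EventuallyEq.deriv_eq ?_
    have c2 : ContinuousAt (fun t : ℝ => (x.1, t)) x.2 := by fun_prop
    filter_upwards [c2.preimage_mem_nhds (hO.mem_nhds hx)] with t ht
    exact ih (x.1, t) ht

theorem polyCurve_add_smul {k : ℕ} (q v : Fin (k + 1) → E) (s t : ℝ) :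
    polyCurve (q + s • v) t = polyCurve q t + s • polyCurve v t := by
  simp only [polyCurve, Pi.add_apply, Pi.smul_apply, smul_add, Finset.sum_add_distrib,
    Finset.smul_sum]
  congr 1
  refine Finset.sum_congr rfl fun j _ => ?_
  rw [smul_comm]

/-- The `i`-th derivative at `0` of `g` along the polynomial curve with given derivatives. -/
def jetComp (k : ℕ) (g : E → F) (i : ℕ) (q : Fin (k + 1) → E) : F :=
  iteratedDeriv i (fun t => g (polyCurve q t)) 0

theorem contDiffOn_jetComp {k : ℕ} {O : Set E} (hO : IsOpen O) {g : E → F}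
    (hg : ContDiffOn ℝ ∞ g O) (i : ℕ) :
    ContDiffOn ℝ ∞ (jetComp k g i) {q : Fin (k + 1) → E | q 0 ∈ O} := by
  have hO' : IsOpen ((fun x : (Fin (k + 1) → E) × ℝ => polyCurve x.1 x.2) ⁻¹' O) :=
    hO.preimage contDiff_polyCurve.continuous
  have h1 := contDiffOn_iteratedDeriv_param hO'
    (hg.comp contDiff_polyCurve.contDiffOn (Set.mapsTo_preimage _ _)) i
  have h2 : ContDiffOn ℝ ∞ (fun q : Fin (k + 1) → E => (q, (0 : ℝ))) {q | q 0 ∈ O} :=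
    contDiffOn_id.prodMk contDiffOn_const
  refine h1.comp h2 fun q hq => ?_
  simpa [polyCurve_zero] using hq

/-- Differentiate along the line q + s v. The polynomial curve depends linearly on its coefficients,
so this is a variation of curves, and d/ds at s = 0 commutes with the i-th derivative in t. -/
theorem fderiv_jetComp_polyCurve {k : ℕ} {O : Set E} (hO : IsOpen O) {g : E → F}
    (hg : ContDiffOn ℝ ∞ g O) (i : ℕ) {q : Fin (k + 1) → E} (hq : q 0 ∈ O)
    (v : Fin (k + 1) → E) :
    fderiv ℝ (jetComp k g i) q v =
      iteratedDeriv i (fun t => fderiv ℝ g (polyCurve q t) (polyCurve v t)) 0 := by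
  have hS : IsOpen {q : Fin (k + 1) → E | q 0 ∈ O} := hO.preimage (continuous_apply 0)
  have hd : DifferentiableAt ℝ (jetComp k g i) q :=
    ((contDiffOn_jetComp hO hg i q hq).contDiffAt (hS.mem_nhds hq)).differentiableAt (by simp)
  have hl : HasDerivAt (fun s : ℝ => q + s • v) v 0 := by
    simpa using ((hasDerivAt_id (0 : ℝ)).smul_const v).const_add q
  have h1 : HasDerivAt (fun s : ℝ => jetComp k g i (q + s • v)) (fderiv ℝ (jetComp k g i) q v) 0 := by
    have h : HasFDerivAt (jetComp k g i) (fderiv ℝ (jetComp k g i) q) (q + (0 : ℝ) • v) := by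
      simpa using hd.hasFDerivAt
    exact h.comp_hasDerivAt (0 : ℝ) hl
  rw [← h1.deriv]
  have hcurve : ContDiff ℝ ∞ (fun x : ℝ × ℝ => polyCurve q x.2 + x.1 • polyCurve v x.2) :=
    ((contDiff_polyCurve_right q).comp contDiff_snd).add
      (contDiff_fst.smul ((contDiff_polyCurve_right v).comp contDiff_snd))
  have hO' := hO.preimage hcurve.continuous
  have hc := deriv_iteratedDeriv_comm hO' (hg.comp hcurve.contDiffOn (Set.mapsTo_preimage _ _)) i
    (0, 0) (by simpa [polyCurve_zero] using hq)
  simp only [Function.comp_apply] at hc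
  simp only [jetComp, polyCurve_add_smul]
  rw [hc]
  refine Filter.EventuallyEq.iteratedDeriv_eq _ ?_
  have hcont : ContinuousAt (polyCurve q) 0 := (contDiff_polyCurve_right q).continuous.continuousAt
  filter_upwards [hcont.preimage_mem_nhds (hO.mem_nhds (by rwa [polyCurve_zero]))] with t ht
  have hgd : DifferentiableAt ℝ g (polyCurve q t) :=
    ((hg _ ht).contDiffAt (hO.mem_nhds ht)).differentiableAt (by simp)
  have hl' : HasDerivAt (fun s : ℝ => polyCurve q t + s • polyCurve v t) (polyCurve v t) 0 := by
    simpa using ((hasDerivAt_id (0 : ℝ)).smul_const (polyCurve v t)).const_add (polyCurve q t)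
  have : HasFDerivAt g (fderiv ℝ g (polyCurve q t)) (polyCurve q t + (0 : ℝ) • polyCurve v t) := by
    simpa using hgd.hasFDerivAt
  exact (this.comp_hasDerivAt (0 : ℝ) hl').deriv

/-- The derivative of `jetComp`, in terms of any curves with the given derivatives at `0`. -/
theorem fderiv_jetComp {k : ℕ} {O : Set E} (hO : IsOpen O) {g : E → F}
    (hg : ContDiffOn ℝ ∞ g O) {i : ℕ} (hi : i ≤ k) {q : Fin (k + 1) → E} (hq : q 0 ∈ O)
    (v : Fin (k + 1) → E) {c w : ℝ → E} (hc : ContDiffAt ℝ ∞ c 0) (hw : ContDiffAt ℝ ∞ w 0)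
    (hcq : ∀ j : Fin (k + 1), iteratedDeriv j c 0 = q j)
    (hwv : ∀ j : Fin (k + 1), iteratedDeriv j w 0 = v j) :
    fderiv ℝ (jetComp k g i) q v = iteratedDeriv i (fun t => fderiv ℝ g (c t) (w t)) 0 := by
  rw [fderiv_jetComp_polyCurve hO hg i hq v]
  have hcp := (contDiff_polyCurve_right q).contDiffAt (x := 0)
  have hvp := (contDiff_polyCurve_right v).contDiffAt (x := 0)
  have hG : ContDiffOn ℝ ∞ (fun x : E × E => fderiv ℝ g x.1 x.2) (Prod.fst ⁻¹' O) :=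
    ((hg.fderiv_of_isOpen hO (m := ∞) (by simp)).comp contDiffOn_fst
      (Set.mapsTo_preimage _ _)).clm_apply contDiffOn_snd
  have hO' : IsOpen (Prod.fst ⁻¹' O : Set (E × E)) := hO.preimage continuous_fst
  -- The composite of (x, y) ↦ Dg(x) y with a pair of curves has an i-jet depending only on the
  -- k-jets of that pair, so the polynomial curves may be replaced by c and w.
  refine iteratedDeriv_comp_congr (k := k) (f₁ := fun t => (polyCurve q t, polyCurve v t))
    (f₂ := fun t => (c t, w t)) (g := fun x : E × E => fderiv ℝ g x.1 x.2)
    (hcp.prodMk hvp) (hc.prodMk hw) ?_ ?_ i hi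
  · have : (polyCurve q 0, polyCurve v 0) ∈ (Prod.fst ⁻¹' O : Set (E × E)) := by
      simpa [polyCurve_zero] using hq
    exact (hG _ this).contDiffAt (hO'.mem_nhds this)
  · intro j hj
    rw [iteratedDeriv_prodMk hcp hvp, iteratedDeriv_prodMk hc hw]
    have h1 := iteratedDeriv_polyCurve q ⟨j, Nat.lt_succ_of_le hj⟩
    have h2 := iteratedDeriv_polyCurve v ⟨j, Nat.lt_succ_of_le hj⟩
    have h3 := hcq ⟨j, Nat.lt_succ_of_le hj⟩
    have h4 := hwv ⟨j, Nat.lt_succ_of_le hj⟩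
    simp only at h1 h2 h3 h4
    rw [h1, h2, h3, h4]

end Calculus

/-! ### Canonical objects of the jet bundles in an arbitrary natural chart -/

section JetCharts

variable {E : Type*} [NormedAddCommGroup E] [NormedSpace ℝ E]
  {Q : Type*} [TopologicalSpace Q] [ChartedSpace E Q] [IsManifold 𝓘(ℝ, E) ∞ Q] {m r : ℕ}

open HTangent

/-- The truncation `(q_0, …, q_m) ↦ (q_0, …, q_r)`. -/
def jetTrunc (h : r ≤ m) : (Fin (m + 1) → E) →L[ℝ] (Fin (r + 1) → E) :=
  ContinuousLinearMap.pi fun i => ContinuousLinearMap.proj (R := ℝ) (φ := fun _ : Fin (m + 1) => E)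
    ⟨i, i.2.trans_le (Nat.succ_le_succ h)⟩

/-- The shift `(q_0, …, q_m) ↦ (q_1, …, q_{r+1})`. -/
def jetShift (h : r < m) : (Fin (m + 1) → E) →L[ℝ] (Fin (r + 1) → E) :=
  ContinuousLinearMap.pi fun i => ContinuousLinearMap.proj (R := ℝ) (φ := fun _ : Fin (m + 1) => E)
    ⟨i + 1, by omega⟩

/-- The vertical endomorphism on the model space. -/
def modelVertEndo (r : ℕ) : (Fin (m + 1) → E) →L[ℝ] (Fin (m + 1) → E) :=
  ContinuousLinearMap.pi fun i : Fin (m + 1) => ((i : ℕ).descFactorial r : ℝ) •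
    ContinuousLinearMap.proj (R := ℝ) (φ := fun _ : Fin (m + 1) => E)
      ⟨(i : ℕ) - r, (Nat.sub_le _ _).trans_lt i.2⟩

@[simp] theorem jetTrunc_apply (h : r ≤ m) (q : Fin (m + 1) → E) (i : Fin (r + 1)) :
    jetTrunc h q i = q ⟨i, i.2.trans_le (Nat.succ_le_succ h)⟩ := rfl

@[simp] theorem jetShift_apply (h : r < m) (q : Fin (m + 1) → E) (i : Fin (r + 1)) :
    jetShift h q i = q ⟨i + 1, by omega⟩ := rfl

@[simp] theorem modelVertEndo_apply (r : ℕ) (v : Fin (m + 1) → E) (i : Fin (m + 1)) :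
    modelVertEndo r v i = ((i : ℕ).descFactorial r : ℝ) •
      v ⟨(i : ℕ) - r, (Nat.sub_le _ _).trans_lt i.2⟩ := rfl

/-- The natural chart of `T^m Q` induced by a chart of `Q`, as an open partial homeomorphism. -/
def jetHomeo (m : ℕ) (φ : OpenPartialHomeomorph Q E) (hφ : φ ∈ atlas E Q) :
    OpenPartialHomeomorph (HTangent E Q m) (Fin (m + 1) → E) :=
  (core E Q m).openPartialHomeomorph (jetChart m φ hφ) ⟨φ, hφ, rfl⟩

variable {φ : OpenPartialHomeomorph Q E} (hφ : φ ∈ atlas E Q)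

theorem jetHomeo_mem_atlas (m : ℕ) :
    jetHomeo m φ hφ ∈ atlas (Fin (m + 1) → E) (HTangent E Q m) :=
  Set.mem_iUnion₂.2 ⟨jetChart m φ hφ, ⟨φ, hφ, rfl⟩, rfl⟩

theorem jetHomeo_mem_maximalAtlas (m : ℕ) :
    jetHomeo m φ hφ ∈ IsManifold.maximalAtlas 𝓘(ℝ, Fin (m + 1) → E) ∞ (HTangent E Q m) :=
  IsManifold.subset_maximalAtlas (jetHomeo_mem_atlas hφ m)

theorem jetHomeo_apply (p : HTangent E Q m) (i : Fin (m + 1)) :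
    jetHomeo m φ hφ p i = coord φ p i := rfl

theorem jetHomeo_symm_apply (q : Fin (m + 1) → E) :
    (jetHomeo m φ hφ).symm q = mk m (chartCurve φ hφ q) := rfl

theorem pos_jetHomeo_symm {q : Fin (m + 1) → E} (hq : q 0 ∈ φ.target) :
    ((jetHomeo m φ hφ).symm q).pos = φ.symm (q 0) := by
  rw [jetHomeo_symm_apply, pos_mk, chartCurve_zero hφ hq]

/-- Both sides are r-jets of polynomial curves in φ whose derivatives at 0 agree up to order r. -/
theorem rho_jetHomeo_symm (h : r ≤ m) {q : Fin (m + 1) → E} (hq : q 0 ∈ φ.target) :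
    rho h ((jetHomeo m φ hφ).symm q) = (jetHomeo r φ hφ).symm (jetTrunc h q) := by
  have hq' : jetTrunc h q 0 ∈ φ.target := hq
  rw [jetHomeo_symm_apply, rho_mk, jetHomeo_symm_apply]
  refine mk_eq_mk hφ ?_ ?_ fun i hi => ?_
  · rw [chartCurve_zero hφ hq]
    exact φ.map_target hq
  · rw [chartCurve_zero hφ hq']
    exact φ.map_target hq
  · exact (iteratedDeriv_chartCurve hφ hq ⟨i, by omega⟩).trans
      (iteratedDeriv_chartCurve hφ hq' ⟨i, by omega⟩).symm

theorem mdifferentiableAt_jetHomeo_symm {q : Fin (m + 1) → E} (hq : q 0 ∈ φ.target) :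
    MDifferentiableAt 𝓘(ℝ, Fin (m + 1) → E) 𝓘(ℝ, Fin (m + 1) → E) (jetHomeo m φ hφ).symm q :=
  mdifferentiableAt_symm_of_mem_maximalAtlas (IsManifold.maximalAtlas_subset_of_le (by simp)
    (jetHomeo_mem_maximalAtlas hφ m)) hq

/-- The frame of `T^m Q` induced by a chart of `Q`: the tangent map of the inverse of the natural
chart. -/
def jetFrame (m : ℕ) (φ : OpenPartialHomeomorph Q E) (hφ : φ ∈ atlas E Q) (q : Fin (m + 1) → E) :
    (Fin (m + 1) → E) →L[ℝ] (Fin (m + 1) → E) :=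
  mfderiv 𝓘(ℝ, Fin (m + 1) → E) 𝓘(ℝ, Fin (m + 1) → E) (jetHomeo m φ hφ).symm q

theorem contDiffOn_chart_comp_symm (hφ : φ ∈ atlas E Q) (x : Q) :
    ContDiffOn ℝ ∞ (chartAt E x ∘ φ.symm) (φ.target ∩ φ.symm ⁻¹' (chartAt E x).source) :=
  contDiffOn_transition hφ (chart_mem_atlas E x)

set_option linter.unusedSectionVars false in
theorem isOpen_chart_comp_symm (x : Q) :
    IsOpen (φ.target ∩ φ.symm ⁻¹' (chartAt E x).source) :=
  φ.isOpen_inter_preimage_symm (chartAt E x).open_source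

set_option linter.unusedSectionVars false in
theorem mem_chart_comp_symm {x : E} (hx : x ∈ φ.target) :
    x ∈ φ.target ∩ φ.symm ⁻¹' (chartAt E (φ.symm x)).source :=
  ⟨hx, mem_chart_source E (φ.symm x)⟩

theorem coord_jetHomeo_symm {x : Q} {q : Fin (m + 1) → E}
    (hq : q 0 ∈ φ.target ∩ φ.symm ⁻¹' (chartAt E x).source) {i : ℕ} (hi : i ≤ m) :
    coord (chartAt E x) ((jetHomeo m φ hφ).symm q) i = jetComp m (chartAt E x ∘ φ.symm) i q := by
  rw [jetHomeo_symm_apply, coord_mk (chart_mem_atlas E x) _ _ hi, chartCurve_val hφ hq.1]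
  · rfl
  · rw [chartCurve_zero hφ hq.1]
    exact hq.2

/-- A tangent space is the model space read through the preferred chart at its base point. The frame
is therefore the derivative of the transition from the chart of φ to that preferred chart, and the
components of this transition are the functions `jetComp`. -/
theorem jetFrame_apply {q : Fin (m + 1) → E} (hq : q 0 ∈ φ.target) (v : Fin (m + 1) → E)
    (i : Fin (m + 1)) :
    jetFrame m φ hφ q v i =
      fderiv ℝ (jetComp m (chartAt E (φ.symm (q 0)) ∘ φ.symm) i) q v := by
  have hs := mdifferentiableAt_jetHomeo_symm hφ hq
  have hO := isOpen_chart_comp_symm (φ := φ) (φ.symm (q 0))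
  have hq' := mem_chart_comp_symm hq
  have hS : IsOpen {q' : Fin (m + 1) → E |
      q' 0 ∈ φ.target ∩ φ.symm ⁻¹' (chartAt E (φ.symm (q 0))).source} :=
    hO.preimage (continuous_apply 0)
  have h1 : jetFrame m φ hφ q = fderiv ℝ (jetHomeo m (chartAt E ((jetHomeo m φ hφ).symm q).pos)
      (chart_mem_atlas E _) ∘ (jetHomeo m φ hφ).symm) q := by
    refine hs.mfderiv.trans ?_
    simp only [writtenInExtChartAt, mfld_simps, fderivWithin_univ]
    rfl
  have h2 : (jetHomeo m (chartAt E ((jetHomeo m φ hφ).symm q).pos)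
      (chart_mem_atlas E _) ∘ (jetHomeo m φ hφ).symm) =ᶠ[𝓝 q]
      fun q' i => jetComp m (chartAt E (φ.symm (q 0)) ∘ φ.symm) i q' := by
    filter_upwards [hS.mem_nhds hq'] with q' hq2
    funext i
    rw [Function.comp_apply, jetHomeo_apply, pos_jetHomeo_symm hφ hq,
      coord_jetHomeo_symm hφ hq2 (Nat.le_of_lt_succ i.2)]
  have hd : ∀ i : Fin (m + 1), DifferentiableAt ℝ
      (jetComp m (chartAt E (φ.symm (q 0)) ∘ φ.symm) i) q := fun i =>
    ((contDiffOn_jetComp hO (contDiffOn_chart_comp_symm hφ _) i q hq').contDiffAt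
      (hS.mem_nhds hq')).differentiableAt (by simp)
  rw [h1, h2.fderiv_eq, fderiv_pi hd]
  rfl

/-- This is the derivative of `rho_jetHomeo_symm`. -/
theorem Trho_jetFrame (h : r ≤ m) {q : Fin (m + 1) → E} (hq : q 0 ∈ φ.target)
    (v : Fin (m + 1) → E) :
    Trho h ((jetHomeo m φ hφ).symm q) (jetFrame m φ hφ q v) =
      jetFrame r φ hφ (jetTrunc h q) (jetTrunc h v) := by
  have hs := (mdifferentiableAt_jetHomeo_symm hφ hq).hasMFDerivAt
  have hs' := (mdifferentiableAt_jetHomeo_symm (m := r) hφ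
    (q := jetTrunc h q) hq).hasMFDerivAt
  have hr := ((contMDiff_rho h).mdifferentiable (by simp)
    ((jetHomeo m φ hφ).symm q)).hasMFDerivAt
  have ht : HasMFDerivAt 𝓘(ℝ, Fin (m + 1) → E) 𝓘(ℝ, Fin (r + 1) → E)
      (jetTrunc h : (Fin (m + 1) → E) → _) q (jetTrunc h) :=
    (jetTrunc (E := E) h).hasFDerivAt.hasMFDerivAt
  have h1 := hr.comp q hs
  have h2 := hs'.comp q ht
  have hS : IsOpen {q' : Fin (m + 1) → E | q' 0 ∈ φ.target} :=
    φ.open_target.preimage (continuous_apply 0)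
  have h3 := h2.congr_of_eventuallyEq (f₁ := rho h ∘ (jetHomeo m φ hφ).symm) (by
    filter_upwards [hS.mem_nhds hq] with q' hq'
    exact rho_jetHomeo_symm hφ h hq')
  exact congrArg (fun f : (Fin (m + 1) → E) →L[ℝ] (Fin (r + 1) → E) => f v)
    (hasMFDerivAt_unique h1 h3)

/-- Frees j_{r+1} from the preferred chart used to define it. For a transition g and a curve c, the
(i+1)-th derivative of g ∘ c is the i-th derivative of Dg(c) c', which is the frame applied to the
jet of c'. -/
theorem inj_jetHomeo_symm (h : r < m) {q : Fin (m + 1) → E} (hq : q 0 ∈ φ.target) :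
    inj h ((jetHomeo m φ hφ).symm q) = jetFrame r φ hφ (jetTrunc h.le q) (jetShift h q) := by
  funext i
  have hq' := mem_chart_comp_symm hq
  have hO := isOpen_chart_comp_symm (φ := φ) (φ.symm (q 0))
  have hg := contDiffOn_chart_comp_symm hφ (φ.symm (q 0))
  have hc := contDiff_polyCurve_right q
  have h1 : inj h ((jetHomeo m φ hφ).symm q) i =
      jetComp m (chartAt E (φ.symm (q 0)) ∘ φ.symm) (i + 1) q := by
    rw [← coord_jetHomeo_symm hφ hq' (by omega), ← pos_jetHomeo_symm hφ hq]
    rfl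
  have h2 : jetFrame r φ hφ (jetTrunc h.le q) (jetShift h q) i =
      fderiv ℝ (jetComp r (chartAt E (φ.symm (q 0)) ∘ φ.symm) i) (jetTrunc h.le q)
        (jetShift h q) := jetFrame_apply hφ (q := jetTrunc h.le q) hq _ i
  rw [h1, h2, fderiv_jetComp hO hg (Nat.le_of_lt_succ i.2) (q := jetTrunc h.le q) hq' _
    (c := polyCurve q) (w := deriv (polyCurve q)) hc.contDiffAt
    ((hc.iterate_deriv 1).contDiffAt) (fun j => iteratedDeriv_polyCurve q ⟨j, by omega⟩) (fun j => by
      rw [← iteratedDeriv_succ']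
      exact iteratedDeriv_polyCurve q ⟨j + 1, by omega⟩), jetComp, iteratedDeriv_succ']
  refine Filter.EventuallyEq.iteratedDeriv_eq _ ?_
  filter_upwards [hc.continuous.continuousAt.preimage_mem_nhds (hO.mem_nhds
    (by rwa [polyCurve_zero] : polyCurve q 0 ∈ _))] with t ht
  have hgd := (((hg _ ht).contDiffAt (hO.mem_nhds ht)).differentiableAt (by simp)).hasFDerivAt
  exact (hgd.comp_hasDerivAt t ((hc.differentiable (by simp)) t).hasDerivAt).deriv

/-- Intrinsically J_r multiplies a variation of curves by t^r. This commutes with changes of chart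
because Dg(c(t)) is linear; Leibniz' rule at 0 produces the descending factorials. -/
theorem vertEndo_jetFrame (r : ℕ) {q : Fin (m + 1) → E} (hq : q 0 ∈ φ.target)
    (v : Fin (m + 1) → E) :
    vertEndo r ((jetHomeo m φ hφ).symm q) (jetFrame m φ hφ q v) =
      jetFrame m φ hφ q (modelVertEndo r v) := by
  funext i
  have hq' := mem_chart_comp_symm hq
  have hO := isOpen_chart_comp_symm (φ := φ) (φ.symm (q 0))
  have hg := contDiffOn_chart_comp_symm hφ (φ.symm (q 0))
  have hc := contDiff_polyCurve_right q
  have hv := contDiff_polyCurve_right v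
  have h1 : vertEndo r ((jetHomeo m φ hφ).symm q) (jetFrame m φ hφ q v) i =
      ((i : ℕ).descFactorial r : ℝ) • jetFrame m φ hφ q v
        ⟨(i : ℕ) - r, (Nat.sub_le _ _).trans_lt i.2⟩ := rfl
  have hi := Nat.le_of_lt_succ i.2
  rw [h1, jetFrame_apply hφ hq, jetFrame_apply hφ hq,
    fderiv_jetComp hO hg ((Nat.sub_le _ _).trans hi) hq' v hc.contDiffAt hv.contDiffAt
      (iteratedDeriv_polyCurve q) (iteratedDeriv_polyCurve v),
    fderiv_jetComp hO hg hi hq' (modelVertEndo r v) (w := fun t => t ^ r • polyCurve v t)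
      hc.contDiffAt (by fun_prop) (iteratedDeriv_polyCurve q) (fun j => by
        rw [iteratedDeriv_pow_smul_zero hv.contDiffAt, modelVertEndo_apply]
        congr 1
        exact iteratedDeriv_polyCurve v ⟨(j : ℕ) - r, (Nat.sub_le _ _).trans_lt j.2⟩)]
  simp only [map_smul]
  rw [iteratedDeriv_pow_smul_zero]
  have h0 : polyCurve q 0 ∈ φ.target ∩ φ.symm ⁻¹' (chartAt E (φ.symm (q 0))).source := by
    rwa [polyCurve_zero]
  have hg' := ((hg.fderiv_of_isOpen hO (m := ∞) (by simp)) _ h0).contDiffAt (hO.mem_nhds h0)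
  exact (hg'.comp (0 : ℝ) hc.contDiffAt).clm_apply hv.contDiffAt

end JetCharts

/-! ### Exterior derivative and pull-backs -/

section ExteriorDerivative

variable {F H F' H' : Type*} [NormedAddCommGroup F] [NormedSpace ℝ F] [TopologicalSpace H]
  {I : ModelWithCorners ℝ F H} {M : Type*} [TopologicalSpace M] [ChartedSpace H M]
  [NormedAddCommGroup F'] [NormedSpace ℝ F'] [TopologicalSpace H']
  {I' : ModelWithCorners ℝ F' H'} {N : Type*} [TopologicalSpace N] [ChartedSpace H' N]

/-- The local representative of a `1`-form in the preferred chart at `x`. -/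
def formRep (θ : OneForm I M) (x : M) (y : F) : F →L[ℝ] ℝ :=
  (θ ((extChartAt I x).symm y)).comp (mfderiv 𝓘(ℝ, F) I (extChartAt I x).symm y)

theorem extDerivForm_apply (θ : OneForm I M) (x : M) (u v : TangentSpace I x) :
    extDerivForm θ x u v = fderiv ℝ (formRep θ x) (extChartAt I x x) u v -
      fderiv ℝ (formRep θ x) (extChartAt I x x) v u := rfl

theorem extDerivForm_self (θ : OneForm I M) (x : M) (u : TangentSpace I x) :
    extDerivForm θ x u u = 0 := by
  rw [extDerivForm_apply, sub_self]

theorem formRep_model (θ : OneForm 𝓘(ℝ, F) F) (x y : F) : formRep θ x y = θ y := by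
  have h : mfderiv 𝓘(ℝ, F) 𝓘(ℝ, F) (id : F → F) y = ContinuousLinearMap.id ℝ F := mfderiv_id
  ext v
  exact congrArg (fun l : F →L[ℝ] F => (θ y : F →L[ℝ] ℝ) (l v)) h

theorem extDerivForm_model (θ : F → F →L[ℝ] ℝ) (x u v : F) :
    extDerivForm (I := 𝓘(ℝ, F)) θ x u v = fderiv ℝ θ x u v - fderiv ℝ θ x v u := by
  have h : formRep (I := 𝓘(ℝ, F)) θ x = θ := funext (formRep_model (F := F) θ x)
  refine (extDerivForm_apply (I := 𝓘(ℝ, F)) θ x u v).trans ?_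
  rw [h]
  rfl

variable [I.Boundaryless] [I'.Boundaryless] [IsManifold I 2 M] [IsManifold I' 2 N]

theorem mdifferentiableAt_extChartAt_symm {x : M} {y : F} (hy : y ∈ (extChartAt I x).target) :
    MDifferentiableAt 𝓘(ℝ, F) I (extChartAt I x).symm y :=
  ((contMDiffOn_extChartAt_symm (n := 2) x).contMDiffAt
    ((isOpen_extChartAt_target x).mem_nhds hy)).mdifferentiableAt (by simp)

/-- The exterior derivative of `1`-forms commutes with pull-backs. -/
theorem extDerivForm_pullback {f : M → N} {x : M} (hf : ContMDiffAt I I' 2 f x)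
    {θ : OneForm I' N} (hθ : DifferentiableAt ℝ (formRep θ (f x)) (extChartAt I' (f x) (f x)))
    {θ' : OneForm I M} (h : ∀ᶠ y in 𝓝 x, θ' y = (θ (f y)).comp (mfderiv I I' f y))
    (u v : TangentSpace I x) :
    extDerivForm θ' x u v = extDerivForm θ (f x) (mfderiv I I' f x u) (mfderiv I I' f x v) := by
  set φ := extChartAt I x with hφ
  set ψ := extChartAt I' (f x) with hψ
  let g : F → F' := ψ ∘ f ∘ φ.symm
  have hsymm : ContinuousAt φ.symm (φ x) := continuousAt_extChartAt_symm x
  have hx : φ.symm (φ x) = x := extChartAt_to_inv x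
  have hg : ContDiffAt ℝ 2 g (φ x) := by
    have := (contMDiffAt_iff.1 hf).2
    rwa [ModelWithCorners.Boundaryless.range_eq_univ, contDiffWithinAt_univ] at this
  have hgx : g (φ x) = ψ (f x) := by simp only [g, Function.comp_apply, hx]
  have hfx : mfderiv I I' f x = fderiv ℝ g (φ x) := by
    refine (hf.mdifferentiableAt (by simp)).mfderiv.trans ?_
    rw [ModelWithCorners.Boundaryless.range_eq_univ, fderivWithin_univ]
    rfl
  -- In the preferred charts at x and f x, the representative of θ' is the pull-back by g of that of
  -- θ.
  have key : formRep θ' x =ᶠ[𝓝 (φ x)] fun y => (formRep θ (f x) (g y)).comp (fderiv ℝ g y) := by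
    have e1 : ∀ᶠ y in 𝓝 (φ x), y ∈ φ.target :=
      (isOpen_extChartAt_target x).mem_nhds (mem_extChartAt_target x)
    have t : Filter.Tendsto φ.symm (𝓝 (φ x)) (𝓝 x) := by
      have := hsymm.tendsto
      rwa [hx] at this
    have e2 := t.eventually h
    have e3 := t.eventually ((contMDiffAt_iff_contMDiffAt_nhds (by simp)).1 hf)
    -- The identity f ∘ φ.symm = ψ.symm ∘ g is going to be differentiated at y, so it has to hold in
    -- a neighbourhood of y.
    have e4 : ∀ᶠ y in 𝓝 (φ x), ∀ᶠ z in 𝓝 y, f (φ.symm z) ∈ ψ.source :=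
      (t.eventually (hf.continuousAt.preimage_mem_nhds
        (extChartAt_source_mem_nhds (I := I') (f x)))).eventually_nhds
    have e5 := (hg.eventually (by simp)).mono fun y hy => hy.differentiableAt (by simp)
    filter_upwards [e1, e2, e3, e4, e5] with y h1 h2 h3 h4 h5
    have h6 : ∀ᶠ z in 𝓝 y, (f ∘ φ.symm) z = (ψ.symm ∘ g) z := by
      filter_upwards [h4] with z hz
      simp only [g, Function.comp_apply]
      rw [ψ.left_inv hz]
    have hgt : g y ∈ ψ.target := ψ.map_source h4.self_of_nhds
    have d1 := (h3.mdifferentiableAt (by simp)).hasMFDerivAt.comp y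
      (mdifferentiableAt_extChartAt_symm h1).hasMFDerivAt
    have d2 := ((mdifferentiableAt_extChartAt_symm hgt).hasMFDerivAt.comp y
      h5.hasFDerivAt.hasMFDerivAt).congr_of_eventuallyEq h6
    have d3 := hasMFDerivAt_unique d1 d2
    ext w
    have d4 := congrArg (fun l : F →L[ℝ] F' => l w) d3
    let θ0 : N → F' →L[ℝ] ℝ := θ
    have hp : θ0 (f (φ.symm y)) = θ0 (ψ.symm (g y)) := congrArg θ0 h6.self_of_nhds
    have l1 : formRep θ' x y w = θ0 (f (φ.symm y))
        (mfderiv I I' f (φ.symm y) (mfderiv 𝓘(ℝ, F) I φ.symm y w)) :=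
      congrArg (fun l : F →L[ℝ] ℝ => l (mfderiv 𝓘(ℝ, F) I φ.symm y w)) h2
    rw [l1, hp]
    exact congrArg (θ0 (ψ.symm (g y))) d4
  have hη : HasFDerivAt (formRep θ (f x)) (fderiv ℝ (formRep θ (f x)) (ψ (f x))) (g (φ x)) := by
    rw [hgx]
    exact hθ.hasFDerivAt
  have hg2 : HasFDerivAt (fderiv ℝ g) (fderiv ℝ (fderiv ℝ g) (φ x)) (φ x) :=
    ((hg.fderiv_right (m := 1) (by norm_num)).differentiableAt (by simp)).hasFDerivAt
  have hd := (hη.comp (φ x) (hg.differentiableAt (by simp)).hasFDerivAt).clm_comp hg2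
  simp only [Function.comp_apply] at hd
  have hsym := (hg.isSymmSndFDerivAt (by simp)).eq u v
  -- The last term contains D²g, which is symmetric, so it cancels when antisymmetrised.
  have hfd : ∀ a b : F, fderiv ℝ (formRep θ' x) (φ x) a b =
      fderiv ℝ (formRep θ (f x)) (ψ (f x)) (fderiv ℝ g (φ x) a) (fderiv ℝ g (φ x) b) +
        formRep θ (f x) (g (φ x)) (fderiv ℝ (fderiv ℝ g) (φ x) a b) := by
    intro a b
    rw [key.fderiv_eq, hd.fderiv]
    simp [add_comm]
  have h1 := hfd u v
  have h2 := hfd v u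
  rw [hfx, extDerivForm_apply, extDerivForm_apply]
  refine (congrArg₂ (· - ·) h1 h2).trans ?_
  rw [hsym]
  exact add_sub_add_right_eq_sub _ _ _

end ExteriorDerivative

/-! ### Smooth and semibasic forms, Tulczyjew's derivation and the Lagrangian 1-form -/

section JetForms

variable {E : Type*} [NormedAddCommGroup E] [NormedSpace ℝ E]
  {Q : Type*} [TopologicalSpace Q] [ChartedSpace E Q] [IsManifold 𝓘(ℝ, E) ∞ Q] {m r : ℕ}

open HTangent

variable {φ : OpenPartialHomeomorph Q E} (hφ : φ ∈ atlas E Q)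

set_option linter.unusedSectionVars false in
theorem isOpen_jetTarget (m : ℕ) (φ : OpenPartialHomeomorph Q E) :
    IsOpen {q : Fin (m + 1) → E | q 0 ∈ φ.target} :=
  φ.open_target.preimage (continuous_apply 0)

theorem contMDiffOn_jetHomeo_symm (m : ℕ) :
    ContMDiffOn 𝓘(ℝ, Fin (m + 1) → E) 𝓘(ℝ, Fin (m + 1) → E) ∞ (jetHomeo m φ hφ).symm
      {q | q 0 ∈ φ.target} :=
  contMDiffOn_symm_of_mem_maximalAtlas (jetHomeo_mem_maximalAtlas hφ m)

theorem contMDiffAt_jetHomeo_symm {q : Fin (m + 1) → E} (hq : q 0 ∈ φ.target) :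
    ContMDiffAt 𝓘(ℝ, Fin (m + 1) → E) 𝓘(ℝ, Fin (m + 1) → E) ∞ (jetHomeo m φ hφ).symm q :=
  contMDiffAt_symm_of_mem_maximalAtlas (jetHomeo_mem_maximalAtlas hφ m) hq

theorem contDiffOn_comp_jetHomeo_symm {f : HTangent E Q m → ℝ}
    (hf : ContMDiff 𝓘(ℝ, Fin (m + 1) → E) 𝓘(ℝ, ℝ) ∞ f) :
    ContDiffOn ℝ ∞ (f ∘ (jetHomeo m φ hφ).symm) {q | q 0 ∈ φ.target} :=
  (hf.comp_contMDiffOn (contMDiffOn_jetHomeo_symm hφ m)).contDiffOn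

theorem contMDiff_of_comp_jetHomeo_symm {f : HTangent E Q m → ℝ}
    (hf : ∀ (φ : OpenPartialHomeomorph Q E) (hφ : φ ∈ atlas E Q),
      ContDiffOn ℝ ∞ (f ∘ (jetHomeo m φ hφ).symm) {q | q 0 ∈ φ.target}) :
    ContMDiff 𝓘(ℝ, Fin (m + 1) → E) 𝓘(ℝ, ℝ) ∞ f := by
  intro p
  have hφ := chart_mem_atlas E p.pos
  set e := jetHomeo m (chartAt E p.pos) hφ with he
  have hp : p ∈ e.source := mem_chart_source E p.pos
  have h1 : ContMDiffAt 𝓘(ℝ, Fin (m + 1) → E) 𝓘(ℝ, Fin (m + 1) → E) ∞ e p :=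
    contMDiffAt_of_mem_maximalAtlas (jetHomeo_mem_maximalAtlas hφ m) hp
  have h2 : ContMDiffAt 𝓘(ℝ, Fin (m + 1) → E) 𝓘(ℝ, ℝ) ∞ (f ∘ e.symm) (e p) :=
    ((hf _ hφ).contDiffAt ((isOpen_jetTarget m _).mem_nhds (e.map_source hp))).contMDiffAt
  refine (h2.comp p h1).congr_of_eventuallyEq ?_
  filter_upwards [e.open_source.mem_nhds hp] with p' hp'
  simp only [Function.comp_apply]
  rw [e.left_inv hp']

theorem dFun_jetFrame {f : HTangent E Q m → ℝ} {q : Fin (m + 1) → E} (hq : q 0 ∈ φ.target)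
    (hf : MDifferentiableAt 𝓘(ℝ, Fin (m + 1) → E) 𝓘(ℝ, ℝ) f ((jetHomeo m φ hφ).symm q))
    (v : Fin (m + 1) → E) :
    dFun (I := 𝓘(ℝ, Fin (m + 1) → E)) f ((jetHomeo m φ hφ).symm q) (jetFrame m φ hφ q v) =
      fderiv ℝ (f ∘ (jetHomeo m φ hφ).symm) q v := by
  have h : HasFDerivAt (f ∘ (jetHomeo m φ hφ).symm)
      ((dFun (I := 𝓘(ℝ, Fin (m + 1) → E)) f ((jetHomeo m φ hφ).symm q) :
        (Fin (m + 1) → E) →L[ℝ] ℝ).comp (jetFrame m φ hφ q)) q :=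
    (hf.hasMFDerivAt.comp q (mdifferentiableAt_jetHomeo_symm hφ hq).hasMFDerivAt).hasFDerivAt
  rw [h.fderiv]
  rfl

/-- The local representative of a `1`-form in the natural chart induced by a chart of `Q`. -/
def jetRep (φ : OpenPartialHomeomorph Q E) (hφ : φ ∈ atlas E Q) (α : JetForm E Q m)
    (q : Fin (m + 1) → E) : (Fin (m + 1) → E) →L[ℝ] ℝ :=
  (α ((jetHomeo m φ hφ).symm q)).comp (jetFrame m φ hφ q)

/-- Smooth `1`-forms: their local representatives are smooth. -/
def IsSmoothForm (α : JetForm E Q m) : Prop :=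
  ∀ (φ : OpenPartialHomeomorph Q E) (hφ : φ ∈ atlas E Q),
    ContDiffOn ℝ ∞ (jetRep φ hφ α) {q | q 0 ∈ φ.target}

/-- `1`-forms which are semibasic over `T^l Q`: only `dq_0, …, dq_l` appear in their local
expressions. -/
def IsSemibasic (l : ℕ) (α : JetForm E Q m) : Prop :=
  ∀ (φ : OpenPartialHomeomorph Q E) (hφ : φ ∈ atlas E Q) (q v : Fin (m + 1) → E),
    q 0 ∈ φ.target → (∀ i : Fin (m + 1), (i : ℕ) ≤ l → v i = 0) → jetRep φ hφ α q v = 0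

theorem IsSmoothForm.differentiableAt {α : JetForm E Q m} (hα : IsSmoothForm α)
    {q : Fin (m + 1) → E} (hq : q 0 ∈ φ.target) : DifferentiableAt ℝ (jetRep φ hφ α) q :=
  ((hα φ hφ).contDiffAt ((isOpen_jetTarget m φ).mem_nhds hq)).differentiableAt (by simp)

/-- The preferred chart at p is itself the natural chart induced by a chart of Q, so `formRep` is
here a case of `jetRep`. -/
theorem IsSmoothForm.differentiableAt_formRep {α : JetForm E Q m} (hα : IsSmoothForm α)
    (p : HTangent E Q m) :
    DifferentiableAt ℝ (formRep α p) (extChartAt 𝓘(ℝ, Fin (m + 1) → E) p p) :=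
  hα.differentiableAt (chart_mem_atlas E p.pos)
    ((jetHomeo m (chartAt E p.pos) (chart_mem_atlas E p.pos)).map_source (mem_chart_source E p.pos))

/-- Pulling α back to the model space by the inverse of the natural chart replaces the preferred
chart at p by any natural one. The point p is kept as a variable because it occurs later as a
projection ρ(p'). -/
theorem extDerivForm_jetFrame {α : JetForm E Q m} (hα : IsSmoothForm α) {q : Fin (m + 1) → E}
    (hq : q 0 ∈ φ.target) {p : HTangent E Q m} (hp : p = (jetHomeo m φ hφ).symm q)
    (u v : Fin (m + 1) → E) :
    extDerivForm α p (jetFrame m φ hφ q u) (jetFrame m φ hφ q v) =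
      fderiv ℝ (jetRep φ hφ α) q u v - fderiv ℝ (jetRep φ hφ α) q v u := by
  subst hp
  rw [← extDerivForm_model]
  exact (extDerivForm_pullback (I := 𝓘(ℝ, Fin (m + 1) → E)) (I' := 𝓘(ℝ, Fin (m + 1) → E))
    ((contMDiffAt_jetHomeo_symm hφ hq).of_le (natCast_le_infty 2))
    (hα.differentiableAt_formRep _) (Filter.Eventually.of_forall fun _ => rfl) u v).symm

/-- The local expression of the interior product with the total derivative. -/
theorem form_inj_jetHomeo_symm (α : JetForm E Q m) (h : m < r) {q : Fin (r + 1) → E}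
    (hq : q 0 ∈ φ.target) :
    α (rho h.le ((jetHomeo r φ hφ).symm q)) (inj h ((jetHomeo r φ hφ).symm q)) =
      jetRep φ hφ α (jetTrunc h.le q) (jetShift h q) := by
  let α' : HTangent E Q m → (Fin (m + 1) → E) →L[ℝ] ℝ := α
  have h1 : α' (rho h.le ((jetHomeo r φ hφ).symm q)) = α' ((jetHomeo m φ hφ).symm (jetTrunc h.le q)) :=
    congrArg α' (rho_jetHomeo_symm hφ h.le hq)
  rw [inj_jetHomeo_symm hφ h hq]
  exact congrArg (fun l : (Fin (m + 1) → E) →L[ℝ] ℝ => l _) h1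

theorem contDiffOn_jetRep_total {α : JetForm E Q m} (hα : IsSmoothForm α) :
    ContDiffOn ℝ ∞ (fun q : Fin (m + 1 + 1) → E => jetRep φ hφ α (jetTrunc (Nat.le_succ m) q)
      (jetShift (Nat.lt_succ_self m) q)) {q | q 0 ∈ φ.target} :=
  ((hα φ hφ).comp (jetTrunc (E := E) (Nat.le_succ m)).contDiff.contDiffOn
    fun _ hq => hq).clm_apply (jetShift (E := E) (Nat.lt_succ_self m)).contDiff.contDiffOn

/-- The interior product of a smooth form with the total derivative is smooth. -/
theorem IsSmoothForm.contMDiff_total {α : JetForm E Q m} (hα : IsSmoothForm α) :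
    ContMDiff 𝓘(ℝ, Fin (m + 1 + 1) → E) 𝓘(ℝ, ℝ) ∞ fun p : HTangent E Q (m + 1) =>
      α (rho (Nat.le_succ m) p) (inj (Nat.lt_succ_self m) p) :=
  contMDiff_of_comp_jetHomeo_symm fun _ hφ => (contDiffOn_jetRep_total hφ hα).congr
    fun _ hq => form_inj_jetHomeo_symm hφ α (Nat.lt_succ_self m) hq

/-- The local expression of Tulczyjew's derivation on `1`-forms. -/
theorem jetRep_tulczyjewForm {α : JetForm E Q m} (hα : IsSmoothForm α)
    {q : Fin (m + 1 + 1) → E} (hq : q 0 ∈ φ.target) (v : Fin (m + 1 + 1) → E) :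
    jetRep φ hφ (tulczyjewForm α) q v =
      fderiv ℝ (jetRep φ hφ α) (jetTrunc (Nat.le_succ m) q) (jetShift (Nat.lt_succ_self m) q)
        (jetTrunc (Nat.le_succ m) v) +
      jetRep φ hφ α (jetTrunc (Nat.le_succ m) q) (jetShift (Nat.lt_succ_self m) v) := by
  set η := jetRep φ hφ α
  set T := jetTrunc (E := E) (Nat.le_succ m)
  set S := jetShift (E := E) (Nat.lt_succ_self m)
  have h1 : jetRep φ hφ (tulczyjewForm α) q v =
      extDerivForm α (rho (Nat.le_succ m) ((jetHomeo (m + 1) φ hφ).symm q))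
        (inj (Nat.lt_succ_self m) ((jetHomeo (m + 1) φ hφ).symm q))
        (Trho (Nat.le_succ m) ((jetHomeo (m + 1) φ hφ).symm q) (jetFrame (m + 1) φ hφ q v)) +
      dFun (fun p' : HTangent E Q (m + 1) =>
        α (rho (Nat.le_succ m) p') (inj (Nat.lt_succ_self m) p')) ((jetHomeo (m + 1) φ hφ).symm q)
        (jetFrame (m + 1) φ hφ q v) := rfl
  have h2 : (fun p' : HTangent E Q (m + 1) =>
      α (rho (Nat.le_succ m) p') (inj (Nat.lt_succ_self m) p')) ∘ (jetHomeo (m + 1) φ hφ).symm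
      =ᶠ[𝓝 q] fun q' => η (T q') (S q') := by
    filter_upwards [(isOpen_jetTarget (m + 1) φ).mem_nhds hq] with q' hq'
    exact form_inj_jetHomeo_symm hφ α (Nat.lt_succ_self m) hq'
  have h3 : HasFDerivAt (fun q' => η (T q') (S q'))
      ((η (T q)).comp S + ((fderiv ℝ η (T q)).comp T).flip (S q)) q :=
    ((hα.differentiableAt hφ (q := T q) hq).hasFDerivAt.comp q T.hasFDerivAt).clm_apply
      S.hasFDerivAt
  -- The term Dη(T v)(S q) enters i_T dα with a minus sign and d i_T α with a plus sign, and
  -- cancels.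
  rw [h1, inj_jetHomeo_symm hφ _ hq, Trho_jetFrame hφ _ hq,
    dFun_jetFrame hφ hq (hα.contMDiff_total.mdifferentiable (by simp) _), h2.fderiv_eq, h3.fderiv,
    extDerivForm_jetFrame hφ hα (q := T q) hq (rho_jetHomeo_symm hφ _ hq)]
  simp only [_root_.add_apply, ContinuousLinearMap.comp_apply, ContinuousLinearMap.flip_apply]
  ring

theorem IsSmoothForm.tulczyjewForm {α : JetForm E Q m} (hα : IsSmoothForm α) :
    IsSmoothForm (tulczyjewForm α) := by
  intro φ hφ
  set T := jetTrunc (E := E) (Nat.le_succ m)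
  set S := jetShift (E := E) (Nat.lt_succ_self m)
  have hT : Set.MapsTo T {q : Fin (m + 1 + 1) → E | q 0 ∈ φ.target} {q | q 0 ∈ φ.target} :=
    fun _ hq => hq
  have h1 := (((hα φ hφ).fderiv_of_isOpen (isOpen_jetTarget m φ) (m := ∞) (by simp)).comp
    T.contDiff.contDiffOn hT).clm_apply S.contDiff.contDiffOn
  have h2 := (hα φ hφ).comp T.contDiff.contDiffOn hT
  refine ((h1.clm_comp contDiffOn_const).add (h2.clm_comp contDiffOn_const)
    (g := fun q => (jetRep φ hφ α (T q)).comp S)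
    (f := fun q => (fderiv ℝ (jetRep φ hφ α) (T q) (S q)).comp T)).congr fun q hq => ?_
  ext v
  exact jetRep_tulczyjewForm hφ hα hq v

/-- Locally d_T(a dq_i) = (d_T a) dq_i + a dq_{i+1}, so the top index grows by one. -/
theorem IsSemibasic.tulczyjewForm {α : JetForm E Q m} (hα : IsSmoothForm α) {l : ℕ}
    (hl : IsSemibasic l α) : IsSemibasic (l + 1) (tulczyjewForm α) := by
  intro φ hφ q v hq hv
  have h1 : ∀ i : Fin (m + 1), (i : ℕ) ≤ l → jetTrunc (Nat.le_succ m) v i = 0 :=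
    fun i hi => hv _ (by simp; omega)
  have h2 : ∀ i : Fin (m + 1), (i : ℕ) ≤ l → jetShift (Nat.lt_succ_self m) v i = 0 :=
    fun i hi => hv _ (by simpa using hi)
  have hq' : jetTrunc (Nat.le_succ m) q ∈ {q : Fin (m + 1) → E | q 0 ∈ φ.target} := hq
  rw [jetRep_tulczyjewForm hφ hα hq, hl φ hφ _ _ hq h2, add_zero]
  -- With the truncated vector held fixed, the form evaluated on it vanishes near the point, hence
  -- so does its derivative.
  have h3 : (fun q' => jetRep φ hφ α q' (jetTrunc (Nat.le_succ m) v))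
      =ᶠ[𝓝 (jetTrunc (Nat.le_succ m) q)] fun _ => (0 : ℝ) := by
    filter_upwards [(isOpen_jetTarget m φ).mem_nhds hq'] with q' hq'
    exact hl φ hφ q' _ hq' h1
  have h4 := ((hα.differentiableAt hφ hq').hasFDerivAt.clm_apply
    (hasFDerivAt_const (jetTrunc (Nat.le_succ m) v) _)).fderiv
  rw [h3.fderiv_eq] at h4
  have h5 := congrArg (fun l => l (jetShift (Nat.lt_succ_self m) q)) h4
  simpa using h5.symm

theorem isSmoothForm_tulczyjewFormIter {α : JetForm E Q m} (hα : IsSmoothForm α) (s : ℕ) :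
    IsSmoothForm (tulczyjewFormIter α s) := by
  induction s with
  | zero => exact hα
  | succ s ih => exact ih.tulczyjewForm

theorem isSemibasic_tulczyjewFormIter {α : JetForm E Q m} (hα : IsSmoothForm α) {l : ℕ}
    (hl : IsSemibasic l α) (s : ℕ) : IsSemibasic (l + s) (tulczyjewFormIter α s) := by
  induction s with
  | zero => exact hl
  | succ s ih => exact ih.tulczyjewForm (isSmoothForm_tulczyjewFormIter hα s)

theorem jetRep_vertDiff {L : HTangent E Q m → ℝ}
    (hL : ContMDiff 𝓘(ℝ, Fin (m + 1) → E) 𝓘(ℝ, ℝ) ∞ L) (r : ℕ) {q : Fin (m + 1) → E}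
    (hq : q 0 ∈ φ.target) (v : Fin (m + 1) → E) :
    jetRep φ hφ (vertDiff r L) q v =
      fderiv ℝ (L ∘ (jetHomeo m φ hφ).symm) q (modelVertEndo r v) := by
  rw [← dFun_jetFrame hφ hq (hL.mdifferentiable (by simp) _), ← vertEndo_jetFrame hφ r hq]
  rfl

theorem isSmoothForm_vertDiff {L : HTangent E Q m → ℝ}
    (hL : ContMDiff 𝓘(ℝ, Fin (m + 1) → E) 𝓘(ℝ, ℝ) ∞ L) (r : ℕ) :
    IsSmoothForm (vertDiff r L) := by
  intro φ hφ
  refine (((contDiffOn_comp_jetHomeo_symm hφ hL).fderiv_of_isOpen (isOpen_jetTarget m φ) (m := ∞)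
    (by simp)).clm_comp (contDiffOn_const (c := modelVertEndo r))).congr fun q hq => ?_
  ext v
  exact jetRep_vertDiff hφ hL r hq v

/-- The slots of J_r v contain only v_0, …, v_{m-r}. -/
theorem isSemibasic_vertDiff {L : HTangent E Q m → ℝ}
    (hL : ContMDiff 𝓘(ℝ, Fin (m + 1) → E) 𝓘(ℝ, ℝ) ∞ L) (r : ℕ) :
    IsSemibasic (m - r) (vertDiff r L) := by
  intro φ hφ q v hq hv
  have h : modelVertEndo r v = 0 := by
    funext i
    rw [modelVertEndo_apply, hv _ (by have := i.2; simp only; omega), smul_zero]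
    rfl
  rw [jetRep_vertDiff hφ hL r hq, h, map_zero]

theorem jetRep_pullRho (h : r ≤ m) (α : JetForm E Q r) {q : Fin (m + 1) → E}
    (hq : q 0 ∈ φ.target) :
    jetRep φ hφ (pullRho h α) q = (jetRep φ hφ α (jetTrunc h q)).comp (jetTrunc h) := by
  ext v
  let α' : HTangent E Q r → (Fin (r + 1) → E) →L[ℝ] ℝ := α
  have h1 : α' (rho h ((jetHomeo m φ hφ).symm q)) = α' ((jetHomeo r φ hφ).symm (jetTrunc h q)) :=
    congrArg α' (rho_jetHomeo_symm hφ h hq)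
  have h2 : jetRep φ hφ (pullRho h α) q v = α' (rho h ((jetHomeo m φ hφ).symm q))
    (Trho h ((jetHomeo m φ hφ).symm q) (jetFrame m φ hφ q v)) := rfl
  rw [h2, h1, Trho_jetFrame hφ h hq]
  rfl

theorem IsSmoothForm.pullRho {α : JetForm E Q r} (hα : IsSmoothForm α) (h : r ≤ m) :
    IsSmoothForm (pullRho h α) := by
  intro φ hφ
  exact (((hα φ hφ).comp (jetTrunc (E := E) h).contDiff.contDiffOn fun _ hq => hq).clm_comp
    (contDiffOn_const (c := jetTrunc h))).congr fun q hq => jetRep_pullRho hφ h α hq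

theorem IsSemibasic.pullRho {α : JetForm E Q r} {l : ℕ} (hα : IsSemibasic l α) (h : r ≤ m) :
    IsSemibasic l (pullRho h α) := by
  intro φ hφ q v hq hv
  rw [jetRep_pullRho hφ h α hq]
  exact hα φ hφ _ _ hq fun i hi => hv _ hi

variable {k : ℕ}

theorem jetRep_lagrangianForm (L : HTangent E Q k → ℝ) (q : Fin (2 * k - 1 + 1) → E) :
    jetRep φ hφ (lagrangianForm L) q =
      ∑ s : Fin k, ((-1 : ℝ) ^ (s : ℕ) / (((s : ℕ) + 1).factorial : ℝ)) •
        jetRep φ hφ (HigherOrder.pullRho (by omega : k + (s : ℕ) ≤ 2 * k - 1)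
          (tulczyjewFormIter (vertDiff ((s : ℕ) + 1) L) (s : ℕ))) q := by
  ext v
  let A : Fin k → (Fin (2 * k - 1 + 1) → E) →L[ℝ] ℝ := fun s =>
    HigherOrder.pullRho (by omega : k + (s : ℕ) ≤ 2 * k - 1)
      (tulczyjewFormIter (vertDiff ((s : ℕ) + 1) L) (s : ℕ)) ((jetHomeo (2 * k - 1) φ hφ).symm q)
  change (∑ s : Fin k, ((-1 : ℝ) ^ (s : ℕ) / (((s : ℕ) + 1).factorial : ℝ)) • A s)
      (jetFrame (2 * k - 1) φ hφ q v) =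
    (∑ s : Fin k, ((-1 : ℝ) ^ (s : ℕ) / (((s : ℕ) + 1).factorial : ℝ)) •
      (A s).comp (jetFrame (2 * k - 1) φ hφ q)) v
  simp

theorem isSmoothForm_lagrangianForm {L : HTangent E Q k → ℝ}
    (hL : ContMDiff 𝓘(ℝ, Fin (k + 1) → E) 𝓘(ℝ, ℝ) ∞ L) :
    IsSmoothForm (lagrangianForm L) := by
  intro φ hφ
  simp only [funext (jetRep_lagrangianForm hφ L)]
  refine ContDiffOn.sum fun s _ => ?_
  have h := (isSmoothForm_tulczyjewFormIter (isSmoothForm_vertDiff hL (s + 1)) s).pullRho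
    (by omega : k + (s : ℕ) ≤ 2 * k - 1) φ hφ
  exact h.const_smul _

/-- With r = s + 1, the s-th term is semibasic over order (k - (s + 1)) + s = k - 1, for every s <
k. This is what makes the Legendre–Ostrogradsky map exist. -/
theorem isSemibasic_lagrangianForm {L : HTangent E Q k → ℝ}
    (hL : ContMDiff 𝓘(ℝ, Fin (k + 1) → E) 𝓘(ℝ, ℝ) ∞ L) :
    IsSemibasic (k - 1) (lagrangianForm L) := by
  intro φ hφ q v hq hv
  rw [jetRep_lagrangianForm]
  simp only [_root_.sum_apply, _root_.smul_apply]
  refine Finset.sum_eq_zero fun s _ => ?_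
  have h := (isSemibasic_tulczyjewFormIter (isSmoothForm_vertDiff hL (s + 1))
    (isSemibasic_vertDiff hL (s + 1)) s).pullRho (by omega : k + (s : ℕ) ≤ 2 * k - 1)
  rw [h φ hφ q v hq fun i hi => hv i (by omega), smul_zero]

end JetForms

/-! ### Contraction with the total derivative, and the energy -/

section TotalDerivative

variable {E : Type*} [NormedAddCommGroup E] [NormedSpace ℝ E]
  {Q : Type*} [TopologicalSpace Q] [ChartedSpace E Q] [IsManifold 𝓘(ℝ, E) ∞ Q] {l m r : ℕ}

open HTangent

/-- The extension `(q_0, …, q_r) ↦ (q_0, …, q_r, 0, …, 0)`. -/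
def jetExtend (r m : ℕ) : (Fin (r + 1) → E) →L[ℝ] (Fin (m + 1) → E) :=
  ContinuousLinearMap.pi fun i => if h : (i : ℕ) < r + 1 then
    ContinuousLinearMap.proj (R := ℝ) (φ := fun _ : Fin (r + 1) => E) ⟨i, h⟩ else 0

theorem jetExtend_apply (q : Fin (r + 1) → E) (i : Fin (m + 1)) (h : (i : ℕ) < r + 1) :
    jetExtend r m q i = q ⟨i, h⟩ := by
  change (dite _ _ _ : (Fin (r + 1) → E) →L[ℝ] E) q = _
  rw [dif_pos h]
  rfl

theorem jetTrunc_jetExtend (h : r ≤ m) (q : Fin (r + 1) → E) :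
    jetTrunc h (jetExtend r m q) = q :=
  funext fun i => jetExtend_apply q _ i.2

theorem exists_jetHomeo_symm_eq (p : HTangent E Q m) :
    ∃ (φ : OpenPartialHomeomorph Q E) (hφ : φ ∈ atlas E Q) (q : Fin (m + 1) → E),
      q 0 ∈ φ.target ∧ p = (jetHomeo m φ hφ).symm q := by
  have hp : p ∈ (jetHomeo m (chartAt E p.pos) (chart_mem_atlas E p.pos)).source :=
    mem_chart_source E p.pos
  exact ⟨_, _, _, OpenPartialHomeomorph.map_source _ hp,
    (OpenPartialHomeomorph.left_inv _ hp).symm⟩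

set_option linter.unusedSectionVars false in
theorem rho_rho (h : l ≤ r) (h' : r ≤ m) (p : HTangent E Q m) :
    rho h (rho h' p) = rho (h.trans h') p := by
  obtain ⟨σ, rfl⟩ := exists_rep p
  rfl

set_option linter.unusedSectionVars false in
-- Used to lift a point of T^{2k-1}Q to T^{2k}Q, where the total derivative becomes a tangent vector
-- at that point.
theorem exists_rho_eq (h : r ≤ m) (p : HTangent E Q r) : ∃ p' : HTangent E Q m, rho h p' = p := by
  obtain ⟨σ, rfl⟩ := exists_rep p
  exact ⟨mk m σ, rfl⟩

theorem inj_rho (h : l < r) (h' : r ≤ m) (p : HTangent E Q m) :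
    (inj h (rho h' p) : Fin (l + 1) → E) = inj (h.trans_le h') p := by
  funext i
  change coord (chartAt E (rho h' p).pos) (rho h' p) (i + 1) = coord (chartAt E p.pos) p (i + 1)
  rw [pos_rho, coord_rho h' (chart_mem_atlas E _) p (mem_chart_source E _) (by omega)]

variable {φ : OpenPartialHomeomorph Q E} (hφ : φ ∈ atlas E Q)

theorem Trho_jetFrame_of_eq (h : r ≤ m) {q : Fin (m + 1) → E} (hq : q 0 ∈ φ.target)
    {p : HTangent E Q m} (hp : p = (jetHomeo m φ hφ).symm q) (v : Fin (m + 1) → E) :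
    Trho h p (jetFrame m φ hφ q v) = jetFrame r φ hφ (jetTrunc h q) (jetTrunc h v) := by
  subst hp
  exact Trho_jetFrame hφ h hq v

theorem Trho_inj (h : l ≤ r) (h' : r < m) (p : HTangent E Q m) :
    (Trho h (rho h'.le p) (inj h' p) : Fin (l + 1) → E) = inj (h.trans_lt h') p := by
  obtain ⟨φ, hφ, q, hq, rfl⟩ := exists_jetHomeo_symm_eq p
  rw [inj_jetHomeo_symm hφ h' hq, inj_jetHomeo_symm hφ (h.trans_lt h') hq,
    Trho_jetFrame_of_eq hφ h (q := jetTrunc h'.le q) hq (rho_jetHomeo_symm hφ h'.le hq)]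
  rfl

/-- The total derivative has components q_1, …, q_{m+1}; for r ≥ 1 the operator J_r discards
q_{m+1}, so the result depends only on the projection to T^m Q. -/
theorem vertEndo_inj {r : ℕ} (hr : 1 ≤ r) (p : HTangent E Q (m + 1)) :
    vertEndo r (rho (Nat.le_succ m) p) (inj (Nat.lt_succ_self m) p) =
      canonicalField r (rho (Nat.le_succ m) p) := by
  funext i
  change ((i : ℕ).descFactorial r : ℝ) • coord (chartAt E p.pos) p ((i : ℕ) - r + 1) =
    ((i : ℕ).descFactorial r : ℝ) • coord (chartAt E (rho (Nat.le_succ m) p).pos)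
      (rho (Nat.le_succ m) p) ((i : ℕ) - r + 1)
  -- For i < r the truncated difference i - r is meaningless, but its coefficient is 0.
  by_cases hi : (i : ℕ) < r
  · rw [Nat.descFactorial_of_lt hi]
    simp
  · rw [pos_rho, coord_rho (Nat.le_succ m) (chart_mem_atlas E _) p (mem_chart_source E _) (by omega)]

/-- If the interior product of a smooth form with the total derivative is the pull-back of a
function, then this function is smooth. -/
theorem contMDiff_of_total_eq {α : JetForm E Q m} (hα : IsSmoothForm α) {f : HTangent E Q m → ℝ}
    (h : ∀ p : HTangent E Q (m + 1), α (rho (Nat.le_succ m) p) (inj (Nat.lt_succ_self m) p) =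
      f (rho (Nat.le_succ m) p)) :
    ContMDiff 𝓘(ℝ, Fin (m + 1) → E) 𝓘(ℝ, ℝ) ∞ f := by
  refine contMDiff_of_comp_jetHomeo_symm fun φ hφ => ?_
  -- The function is recovered by restricting to the local section q_{m+1} = 0 of ρ.
  refine ((contDiffOn_jetRep_total hφ hα).comp (jetExtend (E := E) m (m + 1)).contDiff.contDiffOn
    (s := {q | q 0 ∈ φ.target}) fun q hq => ?_).congr fun q hq => ?_
  · change jetExtend m (m + 1) q 0 ∈ φ.target
    rwa [jetExtend_apply q 0 (by simp)]
  · have hq' : jetExtend m (m + 1) q 0 ∈ φ.target := by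
      rwa [jetExtend_apply q 0 (by simp)]
    have h1 := h ((jetHomeo (m + 1) φ hφ).symm (jetExtend m (m + 1) q))
    rw [form_inj_jetHomeo_symm hφ α (Nat.lt_succ_self m) hq', rho_jetHomeo_symm hφ _ hq',
      jetTrunc_jetExtend] at h1
    simp only [Function.comp_apply]
    rw [jetTrunc_jetExtend]
    exact h1.symm

/-- Writing T for the total derivative, i_T d_T α = dα(T, T) + T(i_T α); the first term vanishes and
the second is d_T f, because T projects onto the total derivative one order lower. -/
theorem tulczyjewForm_total {α : JetForm E Q m} (hα : IsSmoothForm α) {f : HTangent E Q m → ℝ}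
    (h : ∀ p : HTangent E Q (m + 1), α (rho (Nat.le_succ m) p) (inj (Nat.lt_succ_self m) p) =
      f (rho (Nat.le_succ m) p)) (p : HTangent E Q (m + 1 + 1)) :
    tulczyjewForm α (rho (Nat.le_succ (m + 1)) p) (inj (Nat.lt_succ_self (m + 1)) p) =
      tulczyjewFun f (rho (Nat.le_succ (m + 1)) p) := by
  set p' := rho (Nat.le_succ (m + 1)) p with hp'
  have hf := contMDiff_of_total_eq hα h
  have h1 : tulczyjewForm α p' (inj (Nat.lt_succ_self (m + 1)) p) =
      extDerivForm α (rho (Nat.le_succ m) p') (inj (Nat.lt_succ_self m) p')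
        (Trho (Nat.le_succ m) p' (inj (Nat.lt_succ_self (m + 1)) p)) +
      dFun (fun p' : HTangent E Q (m + 1) =>
        α (rho (Nat.le_succ m) p') (inj (Nat.lt_succ_self m) p')) p'
        (inj (Nat.lt_succ_self (m + 1)) p) := rfl
  have h2 : (Trho (Nat.le_succ m) p' (inj (Nat.lt_succ_self (m + 1)) p) : Fin (m + 1) → E) =
      inj (Nat.lt_succ_self m) p' :=
    (Trho_inj (Nat.le_succ m) (Nat.lt_succ_self (m + 1)) p).trans
      (inj_rho (Nat.lt_succ_self m) (Nat.le_succ (m + 1)) p).symm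
  have h3 : (fun p' : HTangent E Q (m + 1) =>
      α (rho (Nat.le_succ m) p') (inj (Nat.lt_succ_self m) p')) = f ∘ rho (Nat.le_succ m) :=
    funext h
  have h4 := mfderiv_comp p' (hf.mdifferentiable (by simp) (rho (Nat.le_succ m) p'))
    ((contMDiff_rho (Nat.le_succ m)).mdifferentiable (by simp) p')
  rw [h1, h2, extDerivForm_self, h3, zero_add]
  refine (congrArg (fun l : (Fin (m + 1 + 1) → E) →L[ℝ] ℝ =>
    l (inj (Nat.lt_succ_self (m + 1)) p)) h4).trans ?_
  exact congrArg (mfderiv 𝓘(ℝ, Fin (m + 1) → E) 𝓘(ℝ, ℝ) f (rho (Nat.le_succ m) p') :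
    (Fin (m + 1) → E) →L[ℝ] ℝ) h2

/-- The interior product with the total derivative commutes with Tulczyjew's derivation. -/
theorem tulczyjewFormIter_total {α : JetForm E Q m} (hα : IsSmoothForm α)
    {f : HTangent E Q m → ℝ}
    (h : ∀ p : HTangent E Q (m + 1), α (rho (Nat.le_succ m) p) (inj (Nat.lt_succ_self m) p) =
      f (rho (Nat.le_succ m) p)) (s : ℕ) : ∀ p : HTangent E Q (m + s + 1),
    tulczyjewFormIter α s (rho (Nat.le_succ (m + s)) p) (inj (Nat.lt_succ_self (m + s)) p) =
      tulczyjewFunIter f s (rho (Nat.le_succ (m + s)) p) := by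
  induction s with
  | zero => exact h
  | succ s ih => exact tulczyjewForm_total (isSmoothForm_tulczyjewFormIter hα s) ih

variable {k : ℕ}

/-- Contracting d_T^s d_{J_{s+1}}L with the total derivative gives d_T^s(Δ_{s+1}(L)), a term of the
energy. The point lies in T^{2k}Q only because the vector involves q_{2k}; the right-hand side does
not depend on it. -/
theorem lagrangianForm_total {L : HTangent E Q k → ℝ} (hk : 1 ≤ k)
    (hL : ContMDiff 𝓘(ℝ, Fin (k + 1) → E) 𝓘(ℝ, ℝ) ∞ L) (p : HTangent E Q (2 * k - 1 + 1)) :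
    lagrangianForm L (rho (Nat.le_succ _) p) (inj (Nat.lt_succ_self _) p) =
      lagrangianEnergy hk L (rho (Nat.le_succ _) p) +
        L (rho (by omega : k ≤ 2 * k - 1) (rho (Nat.le_succ _) p)) := by
  rw [lagrangianEnergy, sub_add_cancel]
  let A : Fin k → (Fin (2 * k - 1 + 1) → E) →L[ℝ] ℝ := fun s =>
    pullRho (by omega : k + (s : ℕ) ≤ 2 * k - 1)
      (tulczyjewFormIter (vertDiff ((s : ℕ) + 1) L) (s : ℕ)) (rho (Nat.le_succ _) p)
  have h1 : lagrangianForm L (rho (Nat.le_succ _) p) (inj (Nat.lt_succ_self _) p) =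
      (∑ s : Fin k, ((-1 : ℝ) ^ (s : ℕ) / (((s : ℕ) + 1).factorial : ℝ)) • A s)
        (inj (Nat.lt_succ_self _) p) := rfl
  have hsum : ∀ u : Fin (2 * k - 1 + 1) → E,
      (∑ s : Fin k, ((-1 : ℝ) ^ (s : ℕ) / (((s : ℕ) + 1).factorial : ℝ)) • A s) u =
        ∑ s : Fin k, ((-1 : ℝ) ^ (s : ℕ) / (((s : ℕ) + 1).factorial : ℝ)) * A s u := fun u => by
    simp only [_root_.sum_apply, _root_.smul_apply, smul_eq_mul]
  refine h1.trans ((hsum _).trans ?_)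
  refine Finset.sum_congr rfl fun s _ => ?_
  congr 1
  have hs : k + (s : ℕ) ≤ 2 * k - 1 := by omega
  have hs' : k + (s : ℕ) + 1 ≤ 2 * k - 1 + 1 := by omega
  have h2 := tulczyjewFormIter_total (isSmoothForm_vertDiff hL ((s : ℕ) + 1))
    (f := fun p' => dFun (I := 𝓘(ℝ, Fin (k + 1) → E)) L p' (canonicalField ((s : ℕ) + 1) p'))
    (fun p' => congrArg (dFun (I := 𝓘(ℝ, Fin (k + 1) → E)) L (rho (Nat.le_succ k) p') :
      (Fin (k + 1) → E) →L[ℝ] ℝ) (vertEndo_inj (Nat.le_add_left 1 s) p')) s (rho hs' p)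
  have h3 : A s (inj (Nat.lt_succ_self _) p) =
      tulczyjewFormIter (vertDiff ((s : ℕ) + 1) L) (s : ℕ) (rho hs (rho (Nat.le_succ _) p))
        (Trho hs (rho (Nat.le_succ _) p) (inj (Nat.lt_succ_self _) p)) := rfl
  have h4 : rho hs (rho (Nat.le_succ _) p) = rho (Nat.le_succ (k + s)) (rho hs' p) := by
    rw [rho_rho, rho_rho]
  have h5 := (Trho_inj hs (Nat.lt_succ_self _) p).trans
    (inj_rho (Nat.lt_succ_self (k + s)) hs' p).symm
  rw [h3, h5, h4]
  exact h2

end TotalDerivative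

/-! ### The Legendre–Ostrogradsky map -/

section Legendre

variable {E : Type*} [NormedAddCommGroup E] [NormedSpace ℝ E]
  {Q : Type*} [TopologicalSpace Q] [ChartedSpace E Q] [IsManifold 𝓘(ℝ, E) ∞ Q] {m k : ℕ}

open HTangent

theorem mfderiv_jetHomeo_jetFrame {φ : OpenPartialHomeomorph Q E} (hφ : φ ∈ atlas E Q)
    {q : Fin (m + 1) → E} (hq : q 0 ∈ φ.target) {p : HTangent E Q m}
    (hp : p = (jetHomeo m φ hφ).symm q) (v : Fin (m + 1) → E) :
    mfderiv 𝓘(ℝ, Fin (m + 1) → E) 𝓘(ℝ, Fin (m + 1) → E) (jetHomeo m φ hφ) p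
      (jetFrame m φ hφ q v) = v := by
  subst hp
  have he : (jetHomeo m φ hφ).MDifferentiable 𝓘(ℝ, Fin (m + 1) → E) 𝓘(ℝ, Fin (m + 1) → E) :=
    mdifferentiable_of_mem_atlas (jetHomeo_mem_atlas hφ m)
  exact congrArg (fun l : (Fin (m + 1) → E) →L[ℝ] (Fin (m + 1) → E) => l v)
    (he.comp_symm_deriv (x := q) hq)

theorem jetFrame_surjective {φ : OpenPartialHomeomorph Q E} (hφ : φ ∈ atlas E Q)
    {q : Fin (m + 1) → E} (hq : q 0 ∈ φ.target) : Function.Surjective (jetFrame m φ hφ q) :=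
  have he : (jetHomeo m φ hφ).MDifferentiable 𝓘(ℝ, Fin (m + 1) → E) 𝓘(ℝ, Fin (m + 1) → E) :=
    mdifferentiable_of_mem_atlas (jetHomeo_mem_atlas hφ m)
  he.symm.mfderiv_surjective (x := q) hq

/-- The defining property of the Legendre-Ostrogradsky map. -/
theorem lagrangianForm_eq_legendre {L : HTangent E Q k → ℝ}
    (hL : ContMDiff 𝓘(ℝ, Fin (k + 1) → E) 𝓘(ℝ, ℝ) ∞ L) (p : HTangent E Q (2 * k - 1))
    (u : TangentSpace 𝓘(ℝ, Fin (2 * k - 1 + 1) → E) p) :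
    lagrangianForm L p u = legendre L p (Trho (by omega : k - 1 ≤ 2 * k - 1) p u) := by
  have hle : k - 1 ≤ 2 * k - 1 := by omega
  have hex : ∃ α : CotangentSpace (Fin (k - 1 + 1) → E) (rho hle p),
      ∀ u, lagrangianForm L p u = α (Trho hle p u) := by
    obtain ⟨φ, hφ, q, hq, rfl⟩ := exists_jetHomeo_symm_eq p
    let B : (Fin (k - 1 + 1) → E) →L[ℝ] (Fin (k - 1 + 1) → E) :=
      mfderiv 𝓘(ℝ, Fin (k - 1 + 1) → E) 𝓘(ℝ, Fin (k - 1 + 1) → E) (jetHomeo (k - 1) φ hφ)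
        (rho hle ((jetHomeo (2 * k - 1) φ hφ).symm q))
    have hB : ∀ v, B (jetFrame (k - 1) φ hφ (jetTrunc hle q) v) = v :=
      mfderiv_jetHomeo_jetFrame hφ (q := jetTrunc hle q) hq (rho_jetHomeo_symm hφ hle hq)
    -- The covector reads a vector in the natural chart through B, extends it by zeros above index k
    -- - 1 and applies θ_L. The error made by this extension has zero slots up to k - 1, so
    -- semibasicity kills it.
    refine ⟨((jetRep φ hφ (lagrangianForm L) q).comp (jetExtend (k - 1) (2 * k - 1))).comp B,
      fun u => ?_⟩
    obtain ⟨v, rfl⟩ := jetFrame_surjective hφ hq u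
    rw [Trho_jetFrame hφ hle hq]
    change jetRep φ hφ (lagrangianForm L) q v = jetRep φ hφ (lagrangianForm L) q
      (jetExtend (k - 1) (2 * k - 1) (B (jetFrame (k - 1) φ hφ (jetTrunc hle q) (jetTrunc hle v))))
    rw [hB, ← sub_eq_zero, ← map_sub]
    refine isSemibasic_lagrangianForm hL φ hφ q _ hq fun i hi => ?_
    rw [Pi.sub_apply, jetExtend_apply _ _ (Nat.lt_succ_of_le hi)]
    exact sub_self _
  rw [legendre, dif_pos hex]
  exact hex.choose_spec u

/-- The local expression of the Legendre-Ostrogradsky map. -/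
theorem legendre_jetFrame {L : HTangent E Q k → ℝ}
    (hL : ContMDiff 𝓘(ℝ, Fin (k + 1) → E) 𝓘(ℝ, ℝ) ∞ L) {φ : OpenPartialHomeomorph Q E}
    (hφ : φ ∈ atlas E Q) {q : Fin (2 * k - 1 + 1) → E} (hq : q 0 ∈ φ.target)
    {p : HTangent E Q (2 * k - 1)} (hp : p = (jetHomeo (2 * k - 1) φ hφ).symm q)
    (w : Fin (k - 1 + 1) → E) :
    legendre L p
        (jetFrame (k - 1) φ hφ (jetTrunc (by omega : k - 1 ≤ 2 * k - 1) q) w) =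
      jetRep φ hφ (lagrangianForm L) q (jetExtend (k - 1) (2 * k - 1) w) := by
  subst hp
  have hle : k - 1 ≤ 2 * k - 1 := by omega
  have h := Trho_jetFrame hφ hle hq (jetExtend (k - 1) (2 * k - 1) w)
  rw [jetTrunc_jetExtend] at h
  exact ((lagrangianForm_eq_legendre hL _ _).trans
    (congrArg (legendre L _ : (Fin (k - 1 + 1) → E) →L[ℝ] ℝ) h)).symm

/-- Since the lifted total derivative projects to j_k(p), the coupling on the graph is the
contraction of θ_L with it, that is E_L + L. -/
theorem hamiltonian_graphMap {L : HTangent E Q k → ℝ} (hk : 1 ≤ k)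
    (hL : ContMDiff 𝓘(ℝ, Fin (k + 1) → E) 𝓘(ℝ, ℝ) ∞ L) (p : HTangent E Q (2 * k - 1)) :
    hamiltonian hk L (graphMap L p) = lagrangianEnergy hk L p := by
  obtain ⟨p, rfl⟩ := exists_rho_eq (Nat.le_succ (2 * k - 1)) p
  have h := lagrangianForm_total hk hL p
  have hle : k - 1 ≤ 2 * k - 1 := by omega
  have hlt : k - 1 < 2 * k - 1 := by omega
  rw [lagrangianForm_eq_legendre hL] at h
  have h5 : (Trho hle (rho (Nat.le_succ _) p) (inj (Nat.lt_succ_self _) p) : Fin (k - 1 + 1) → E) =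
      inj hlt (rho (Nat.le_succ _) p) :=
    (Trho_inj hle (Nat.lt_succ_self _) p).trans (inj_rho hlt (Nat.le_succ _) p).symm
  rw [h5] at h
  exact sub_eq_of_eq_add h

end Legendre

/-! ### The Liouville form in coordinates -/

section CotangentBundle

variable {F : Type*} [NormedAddCommGroup F] [NormedSpace ℝ F]
  {M : Type*} [TopologicalSpace M] [ChartedSpace F M] [IsManifold 𝓘(ℝ, F) ∞ M]

/-- The trivialization of the dual bundle precomposes a covector with the inverse tangent
trivialization, which is the derivative of the inverse chart. -/
theorem cotangent_trivializationAt_apply (x₀ : M) (a : CotangentBundle F M)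
    (h : a.proj ∈ (chartAt F x₀).source) (u : F) :
    (trivializationAt (F →L[ℝ] ℝ) (fun x : M => CotangentSpace F x) x₀ a).2 u =
      a.2 (mfderiv 𝓘(ℝ, F) 𝓘(ℝ, F) (extChartAt 𝓘(ℝ, F) x₀).symm
        (extChartAt 𝓘(ℝ, F) x₀ a.proj) u) := by
  have h1 := TangentBundle.symmL_trivializationAt (I := 𝓘(ℝ, F)) h
  rw [ModelWithCorners.Boundaryless.range_eq_univ, mfderivWithin_univ] at h1
  have h2 : (trivializationAt (F →L[ℝ] ℝ) (fun x : M => CotangentSpace F x) x₀ a).2 u =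
      (trivializationAt ℝ (fun _ : M => ℝ) x₀).continuousLinearMapAt ℝ a.proj
        (a.2 ((trivializationAt F (TangentSpace 𝓘(ℝ, F)) x₀).symmL ℝ a.proj u)) := rfl
  have h3 : (trivializationAt ℝ (fun _ : M => ℝ) x₀).continuousLinearMapAt ℝ a.proj =
      ContinuousLinearMap.id ℝ ℝ := Trivial.continuousLinearMapAt_trivialization ℝ M ℝ a.proj
  rw [h2, h3, h1]
  rfl

/-- The local expression `p dq` of the Liouville form. -/
theorem formRep_liouvilleForm (a : CotangentBundle F M) :
    formRep (liouvilleForm F M) a =ᶠ[𝓝 (extChartAt (cotangentModel F) a a)]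
      fun y => y.2.comp (ContinuousLinearMap.fst ℝ F (F →L[ℝ] ℝ)) := by
  set e := extChartAt (cotangentModel F) a with he
  set φ := extChartAt 𝓘(ℝ, F) a.proj with hφ
  let T := trivializationAt (F →L[ℝ] ℝ) (fun x : M => CotangentSpace F x) a.proj
  have heT : e = T.toPartialEquiv ≫ φ.prod (PartialEquiv.refl _) := FiberBundle.extChartAt a
  have htarget : e.target = (φ.target ∩ φ.symm ⁻¹' T.baseSet) ×ˢ Set.univ :=
    FiberBundle.extChartAt_target a
  have hproj : ∀ y ∈ e.target, (e.symm y).proj = φ.symm y.1 := by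
    intro y hy
    rw [htarget] at hy
    rw [heT]
    exact T.proj_symm_apply' hy.1.2
  have hfib : ∀ y ∈ e.target, (T (e.symm y)).2 = y.2 := by
    intro y hy
    rw [htarget] at hy
    rw [heT]
    exact congrArg Prod.snd (T.apply_symm_apply' (x := y.2) hy.1.2)
  have hO : IsOpen e.target := isOpen_extChartAt_target a
  filter_upwards [hO.mem_nhds (mem_extChartAt_target a)] with y hy
  have hz : y.1 ∈ φ.target := by
    have := hy
    rw [htarget] at this
    exact this.1.1
  have hsrc : (e.symm y).proj ∈ (chartAt F a.proj).source := by
    rw [hproj y hy, ← extChartAt_source 𝓘(ℝ, F)]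
    exact φ.map_target hz
  have hφz : φ (e.symm y).proj = y.1 := by
    rw [hproj y hy]
    exact φ.right_inv hz
  have d1 := ((contMDiff_proj (fun x : M => CotangentSpace F x) (IB := 𝓘(ℝ, F))
    (n := ∞)).mdifferentiable (by simp) (e.symm y)).hasMFDerivAt.comp y
      (mdifferentiableAt_extChartAt_symm hy).hasMFDerivAt
  have d2 := ((mdifferentiableAt_extChartAt_symm hz).hasMFDerivAt.comp y
    (hasFDerivAt_fst (𝕜 := ℝ) (p := y)).hasMFDerivAt).congr_of_eventuallyEq
      (by filter_upwards [hO.mem_nhds hy] with y' hy' using hproj y' hy')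
  have d3 := hasMFDerivAt_unique d1 d2
  refine ContinuousLinearMap.ext fun u => ?_
  have d4 := congrArg (fun l : F × (F →L[ℝ] ℝ) →L[ℝ] F => l u) d3
  let β : F →L[ℝ] ℝ := (e.symm y).2
  let A : F → F →L[ℝ] F := fun z => mfderiv 𝓘(ℝ, F) 𝓘(ℝ, F) φ.symm z
  have h1 : (T (e.symm y)).2 u.1 = β (A (φ (e.symm y).proj) u.1) :=
    cotangent_trivializationAt_apply a.proj (e.symm y) hsrc u.1
  rw [hφz, hfib y hy] at h1
  exact (congrArg β d4).trans h1.symm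

theorem differentiableAt_formRep_liouvilleForm (a : CotangentBundle F M) :
    DifferentiableAt ℝ (formRep (liouvilleForm F M) a) (extChartAt (cotangentModel F) a a) := by
  have h : DifferentiableAt ℝ (fun y : F × (F →L[ℝ] ℝ) =>
      y.2.comp (ContinuousLinearMap.fst ℝ F (F →L[ℝ] ℝ)))
      (extChartAt (cotangentModel F) a a) := by fun_prop
  exact h.congr_of_eventuallyEq (formRep_liouvilleForm a)

end CotangentBundle

/-! ### The graph in the unified phase space, and projection of the dynamics -/

section UnifiedDynamics

open HTangent

variable {E : Type*} [NormedAddCommGroup E] [NormedSpace ℝ E]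
  {Q : Type*} [TopologicalSpace Q] [ChartedSpace E Q] [IsManifold 𝓘(ℝ, E) ∞ Q] {k l m : ℕ}

theorem contMDiff_pr1 : ContMDiff (unifiedModel E k) 𝓘(ℝ, Fin (2 * k - 1 + 1) → E) ∞
    (pr1 : UnifiedSpace E Q k → HTangent E Q (2 * k - 1)) :=
  contMDiff_proj _

/-- The pull-back bundle and the cotangent bundle have the same fibre component in corresponding
trivializations, so only the base map ρ has to be checked. -/
theorem contMDiff_pr2 : ContMDiff (unifiedModel E k) (cotangentModel (Fin (k - 1 + 1) → E)) ∞
    (pr2 : UnifiedSpace E Q k →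
      CotangentBundle (Fin (k - 1 + 1) → E) (HTangent E Q (k - 1))) := by
  intro w
  have hle : k - 1 ≤ 2 * k - 1 := by omega
  have h := contMDiffAt_totalSpace.1 (contMDiffAt_id (I := unifiedModel E k) (n := ∞) (x := w))
  exact contMDiffAt_totalSpace.2 ⟨((contMDiff_rho hle _).comp w h.1 :), h.2⟩

theorem jetHomeo_rho (h : l ≤ m) {φ : OpenPartialHomeomorph Q E} (hφ : φ ∈ atlas E Q)
    {p : HTangent E Q m} (hp : p.pos ∈ φ.source) :
    jetHomeo l φ hφ (rho h p) = jetTrunc h (jetHomeo m φ hφ p) :=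
  funext fun i => coord_rho h hφ p hp (Nat.le_of_lt_succ i.2)

theorem eventually_mem_jetHomeo_source (p₀ : HTangent E Q m) {φ : OpenPartialHomeomorph Q E}
    (hφ : φ ∈ atlas E Q) (hp : p₀.pos ∈ φ.source) :
    ∀ᶠ p in 𝓝 p₀, p ∈ (jetHomeo m φ hφ).source :=
  (jetHomeo m φ hφ).open_source.mem_nhds hp

theorem contMDiffAt_jetHomeo {p : HTangent E Q m} {φ : OpenPartialHomeomorph Q E}
    (hφ : φ ∈ atlas E Q) (hp : p.pos ∈ φ.source) :
    ContMDiffAt 𝓘(ℝ, Fin (m + 1) → E) 𝓘(ℝ, Fin (m + 1) → E) ∞ (jetHomeo m φ hφ) p :=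
  contMDiffAt_of_mem_maximalAtlas (jetHomeo_mem_maximalAtlas hφ m) hp

/-- In the tangent trivialization at ρ(p₀) the fibre component is the linear shift of the natural
coordinates. -/
theorem contMDiff_inj (h : l < m) : ContMDiff 𝓘(ℝ, Fin (m + 1) → E)
    (𝓘(ℝ, Fin (l + 1) → E)).tangent ∞
    (fun p : HTangent E Q m => (⟨rho h.le p, inj h p⟩ :
      TangentBundle 𝓘(ℝ, Fin (l + 1) → E) (HTangent E Q l))) := by
  intro p₀
  refine contMDiffAt_totalSpace.2 ⟨contMDiff_rho h.le p₀, ?_⟩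
  have hφ := chart_mem_atlas E (rho h.le p₀).pos
  set φ := chartAt E (rho h.le p₀).pos
  have hp₀ : p₀.pos ∈ φ.source := by
    rw [← pos_rho h.le]
    exact mem_chart_source E _
  refine ((jetShift (E := E) h).contMDiff.contMDiffAt.comp p₀
    (contMDiffAt_jetHomeo hφ hp₀)).congr_of_eventuallyEq ?_
  filter_upwards [eventually_mem_jetHomeo_source p₀ hφ hp₀] with p hp
  have hq := (jetHomeo m φ hφ).map_source hp
  have hinj := inj_jetHomeo_symm hφ h hq
  rw [(jetHomeo m φ hφ).left_inv hp] at hinj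
  have hsrc : rho h.le p ∈ (chartAt (Fin (l + 1) → E) (rho h.le p₀)).source := by
    change (rho h.le p).pos ∈ φ.source
    rwa [pos_rho]
  have h1 := TangentBundle.continuousLinearMapAt_trivializationAt
    (I := 𝓘(ℝ, Fin (l + 1) → E)) hsrc
  have h2 := (trivializationAt (Fin (l + 1) → E) (TangentSpace 𝓘(ℝ, Fin (l + 1) → E))
    (rho h.le p₀)).continuousLinearMapAt_apply_of_mem (R := ℝ) (b := rho h.le p) hsrc (inj h p)
  rw [← h2, h1, hinj]
  exact mfderiv_jetHomeo_jetFrame hφ (q := jetTrunc h.le (jetHomeo m φ hφ p)) hq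
    (by rw [← jetHomeo_rho h.le hφ hp]; exact ((jetHomeo l φ hφ).left_inv hsrc).symm) _

/-- In the cotangent trivialization the fibre component is the local representative of θ_L
restricted to the slots 0, …, k - 1, which is smooth although `legendre` is defined by choice. -/
theorem contMDiff_graphMap {L : HTangent E Q k → ℝ}
    (hL : ContMDiff 𝓘(ℝ, Fin (k + 1) → E) 𝓘(ℝ, ℝ) ∞ L) :
    ContMDiff 𝓘(ℝ, Fin (2 * k - 1 + 1) → E) (unifiedModel E k) ∞ (graphMap L) := by
  intro p₀
  have hle : k - 1 ≤ 2 * k - 1 := by omega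
  refine contMDiffAt_totalSpace.2 ⟨contMDiffAt_id, ?_⟩
  have hφ := chart_mem_atlas E (rho hle p₀).pos
  set φ := chartAt E (rho hle p₀).pos with hφdef
  have hp₀ : p₀.pos ∈ φ.source := by
    rw [hφdef, ← pos_rho hle]
    exact mem_chart_source E _
  have h1 : ContDiffAt ℝ ∞ (fun q => (jetRep φ hφ (lagrangianForm L) q).comp
      (jetExtend (k - 1) (2 * k - 1))) (jetHomeo (2 * k - 1) φ hφ p₀) :=
    ((isSmoothForm_lagrangianForm hL φ hφ).contDiffAt ((isOpen_jetTarget _ φ).mem_nhds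
      ((jetHomeo (2 * k - 1) φ hφ).map_source hp₀))).clm_comp contDiffAt_const
  refine (h1.contMDiffAt.comp p₀ (contMDiffAt_jetHomeo hφ hp₀)).congr_of_eventuallyEq ?_
  filter_upwards [eventually_mem_jetHomeo_source p₀ hφ hp₀] with p hp
  have hq := (jetHomeo (2 * k - 1) φ hφ).map_source hp
  have hsrc : rho hle p ∈ (chartAt (Fin (k - 1 + 1) → E) (rho hle p₀)).source := by
    change (rho hle p).pos ∈ φ.source
    rwa [pos_rho]
  refine ContinuousLinearMap.ext fun u => ?_
  refine (cotangent_trivializationAt_apply (rho hle p₀) (pr2 (graphMap L p)) hsrc u).trans ?_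
  refine Eq.trans ?_ (legendre_jetFrame hL hφ hq ((jetHomeo (2 * k - 1) φ hφ).left_inv hp).symm u)
  rw [← jetHomeo_rho hle hφ hp]
  rfl

theorem contMDiff_coupling (hk : 1 ≤ k) :
    ContMDiff (unifiedModel E k) 𝓘(ℝ, ℝ) ∞ (coupling hk : UnifiedSpace E Q k → ℝ) := by
  intro w
  have h1 : ContMDiffAt (unifiedModel E k) (cotangentModel (Fin (k - 1 + 1) → E)) ∞
      (pr2 : UnifiedSpace E Q k → _) w := contMDiff_pr2 w
  have hlt : k - 1 < 2 * k - 1 := by omega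
  have h2 := (contMDiff_inj (E := E) (Q := Q) hlt).contMDiffAt.comp w (contMDiff_pr1 w)
  have h3 := ContMDiffAt.clm_bundle_apply (F₁ := Fin (k - 1 + 1) → E) (F₂ := ℝ)
    (E₁ := fun x : HTangent E Q (k - 1) => TangentSpace 𝓘(ℝ, Fin (k - 1 + 1) → E) x)
    (E₂ := fun _ : HTangent E Q (k - 1) => ℝ) (b := fun w : UnifiedSpace E Q k => rho hlt.le (pr1 w))
    (ϕ := fun w => (pr2 w).2) (v := fun w => inj hlt (pr1 w)) h1 h2
  exact (contMDiffAt_totalSpace.1 h3).2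

theorem contMDiff_hamiltonian (hk : 1 ≤ k) {L : HTangent E Q k → ℝ}
    (hL : ContMDiff 𝓘(ℝ, Fin (k + 1) → E) 𝓘(ℝ, ℝ) ∞ L) :
    ContMDiff (unifiedModel E k) 𝓘(ℝ, ℝ) ∞ (hamiltonian hk L : UnifiedSpace E Q k → ℝ) :=
  (contMDiff_coupling hk).sub (hL.comp ((contMDiff_rho _).comp contMDiff_pr1))

/-- The Lagrangian `1`-form is the pull-back of the Liouville form by the Legendre-Ostrogradsky
map. -/
theorem lagrangianForm_eq_pullback {L : HTangent E Q k → ℝ}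
    (hL : ContMDiff 𝓘(ℝ, Fin (k + 1) → E) 𝓘(ℝ, ℝ) ∞ L) (p : HTangent E Q (2 * k - 1)) :
    lagrangianForm L p = (liouvilleForm (Fin (k - 1 + 1) → E) (HTangent E Q (k - 1))
      ((pr2 ∘ graphMap L) p)).comp (mfderiv 𝓘(ℝ, Fin (2 * k - 1 + 1) → E)
        (cotangentModel (Fin (k - 1 + 1) → E)) (pr2 ∘ graphMap L) p) := by
  refine ContinuousLinearMap.ext fun u => (lagrangianForm_eq_legendre hL p u).trans ?_
  have h1 : mfderiv 𝓘(ℝ, Fin (2 * k - 1 + 1) → E) 𝓘(ℝ, Fin (k - 1 + 1) → E)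
      ((TotalSpace.proj : CotangentBundle (Fin (k - 1 + 1) → E) (HTangent E Q (k - 1)) → _) ∘
        (pr2 ∘ graphMap L)) p = _ :=
    mfderiv_comp p ((contMDiff_proj _ (n := ∞)).mdifferentiable (by simp) _)
      ((contMDiff_pr2.comp (contMDiff_graphMap hL)).mdifferentiable (by simp) p)
  exact congrArg (fun l : (Fin (2 * k - 1 + 1) → E) →L[ℝ] (Fin (k - 1 + 1) → E) =>
    (legendre L p : (Fin (k - 1 + 1) → E) →L[ℝ] ℝ) (l u)) h1

/-- The Lagrangian `2`-form is the pull-back of the presymplectic form of `W` by the graph map. -/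
theorem lagrangianTwoForm_eq_pullback {L : HTangent E Q k → ℝ}
    (hL : ContMDiff 𝓘(ℝ, Fin (k + 1) → E) 𝓘(ℝ, ℝ) ∞ L) (p : HTangent E Q (2 * k - 1))
    (u v : TangentSpace 𝓘(ℝ, Fin (2 * k - 1 + 1) → E) p) :
    lagrangianTwoForm L p u v = unifiedTwoForm (graphMap L p)
      (mfderiv 𝓘(ℝ, Fin (2 * k - 1 + 1) → E) (unifiedModel E k) (graphMap L) p u)
      (mfderiv 𝓘(ℝ, Fin (2 * k - 1 + 1) → E) (unifiedModel E k) (graphMap L) p v) := by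
  have h1 := extDerivForm_pullback (I' := cotangentModel (Fin (k - 1 + 1) → E))
    (((contMDiff_pr2.comp (contMDiff_graphMap hL)) p).of_le (natCast_le_infty 2))
    (differentiableAt_formRep_liouvilleForm _)
    (Filter.Eventually.of_forall (lagrangianForm_eq_pullback hL)) u v
  have h2 := mfderiv_comp p (contMDiff_pr2.mdifferentiable (by simp) (graphMap L p))
    ((contMDiff_graphMap hL).mdifferentiable (by simp) p)
  rw [h2] at h1
  exact congrArg Neg.neg h1

/-- The graph map is a section of pr₁. -/
theorem Tpr1_mfderiv_graphMap {L : HTangent E Q k → ℝ}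
    (hL : ContMDiff 𝓘(ℝ, Fin (k + 1) → E) 𝓘(ℝ, ℝ) ∞ L) (p : HTangent E Q (2 * k - 1))
    (u : TangentSpace 𝓘(ℝ, Fin (2 * k - 1 + 1) → E) p) :
    Tpr1 (graphMap L p)
      (mfderiv 𝓘(ℝ, Fin (2 * k - 1 + 1) → E) (unifiedModel E k) (graphMap L) p u) = u := by
  have h : mfderiv 𝓘(ℝ, Fin (2 * k - 1 + 1) → E) 𝓘(ℝ, Fin (2 * k - 1 + 1) → E)
      (id : HTangent E Q (2 * k - 1) → _) p = _ :=
    mfderiv_comp p (contMDiff_pr1.mdifferentiable (by simp) (graphMap L p))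
      ((contMDiff_graphMap hL).mdifferentiable (by simp) p)
  rw [mfderiv_id] at h
  exact (congrArg (fun l : (Fin (2 * k - 1 + 1) → E) →L[ℝ] (Fin (2 * k - 1 + 1) → E) => l u) h).symm

theorem dFun_hamiltonian_mfderiv_graphMap {L : HTangent E Q k → ℝ} (hk : 1 ≤ k)
    (hL : ContMDiff 𝓘(ℝ, Fin (k + 1) → E) 𝓘(ℝ, ℝ) ∞ L) (p : HTangent E Q (2 * k - 1))
    (v : TangentSpace 𝓘(ℝ, Fin (2 * k - 1 + 1) → E) p) :
    dFun (I := unifiedModel E k) (hamiltonian hk L) (graphMap L p)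
      (mfderiv 𝓘(ℝ, Fin (2 * k - 1 + 1) → E) (unifiedModel E k) (graphMap L) p v) =
    dFun (I := 𝓘(ℝ, Fin (2 * k - 1 + 1) → E)) (lagrangianEnergy hk L) p v := by
  have h := mfderiv_comp p ((contMDiff_hamiltonian hk hL).mdifferentiable (by simp) (graphMap L p))
    ((contMDiff_graphMap hL).mdifferentiable (by simp) p)
  rw [show hamiltonian hk L ∘ graphMap L = lagrangianEnergy hk L from
    funext (hamiltonian_graphMap hk hL)] at h
  exact (congrArg (fun l : (Fin (2 * k - 1 + 1) → E) →L[ℝ] ℝ => l v) h).symm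

variable {X : (w : UnifiedSpace E Q k) → TangentSpace (unifiedModel E k) w}
  {XL : (p : HTangent E Q (2 * k - 1)) → TangentSpace 𝓘(ℝ, Fin (2 * k - 1 + 1) → E) p}

theorem isAssociatedField_Tpr1 {L : HTangent E Q k → ℝ}
    (hL : ContMDiff 𝓘(ℝ, Fin (k + 1) → E) 𝓘(ℝ, ℝ) ∞ L) (hX : IsFieldOn (graphSet L) X) :
    IsAssociatedField L X fun p => Tpr1 (graphMap L p) (X (graphMap L p)) := by
  refine ⟨?_, ?_⟩
  -- X is smooth only along the graph, but the graph map takes all its values there, so the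
  -- composite is smooth on the whole of T^{2k-1}Q.
  · have h1 := hX.comp_contMDiff (contMDiff_graphMap hL) fun p => ⟨p, rfl⟩
    exact (contMDiff_pr1.contMDiff_tangentMap (m := ∞) (by simp)).comp h1
  · rintro _ ⟨p, rfl⟩
    rfl

theorem IsAssociatedField.eq_Tpr1 {L : HTangent E Q k → ℝ} (h : IsAssociatedField L X XL)
    (p : HTangent E Q (2 * k - 1)) : XL p = Tpr1 (graphMap L p) (X (graphMap L p)) :=
  h.2 (graphMap L p) ⟨p, rfl⟩

/-- Tangency writes X on the graph as the image of X_L under the tangent graph map; the unified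
equation on vectors tangent to the graph then pulls back to the Lagrangian equation. -/
theorem IsAssociatedField.isLagrangianField {L : HTangent E Q k → ℝ} (hk : 1 ≤ k)
    (hL : ContMDiff 𝓘(ℝ, Fin (k + 1) → E) 𝓘(ℝ, ℝ) ∞ L) (hXtan : IsTangentToGraph L X)
    (hXsol : IsUnifiedSolution hk L X) (h : IsAssociatedField L X XL) :
    IsLagrangianField hk L XL := by
  intro p
  obtain ⟨u, hu⟩ := hXtan p
  have h1 : XL p = u := by rw [h.eq_Tpr1, ← hu, Tpr1_mfderiv_graphMap hL]
  refine ContinuousLinearMap.ext fun v => ?_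
  rw [h1, lagrangianTwoForm_eq_pullback hL, hu, hXsol _ ⟨p, rfl⟩,
    dFun_hamiltonian_mfderiv_graphMap hk hL]

theorem IsAssociatedField.isMIntegralCurveOn {L : HTangent E Q k → ℝ}
    (h : IsAssociatedField L X XL) {I : Set ℝ} {σ : ℝ → UnifiedSpace E Q k}
    (hσ : ∀ t ∈ I, σ t ∈ graphSet L) (hI : IsMIntegralCurveOn (I := unifiedModel E k) σ X I) :
    IsMIntegralCurveOn (I := 𝓘(ℝ, Fin (2 * k - 1 + 1) → E)) (pr1 ∘ σ) XL I := by
  intro t ht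
  have h1 := (contMDiff_pr1.mdifferentiable (by simp) (σ t)).hasMFDerivAt.comp_hasMFDerivWithinAt t
    (hI t ht)
  let A : (Fin (2 * k - 1 + 1) → E) × ((Fin (k - 1 + 1) → E) →L[ℝ] ℝ) →L[ℝ]
    (Fin (2 * k - 1 + 1) → E) := Tpr1 (σ t)
  let x : (Fin (2 * k - 1 + 1) → E) × ((Fin (k - 1 + 1) → E) →L[ℝ] ℝ) := X (σ t)
  let y : Fin (2 * k - 1 + 1) → E := XL ((pr1 ∘ σ) t)
  have h2 : y = A x := h.2 _ (hσ t ht)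
  have h3 : A.comp ((1 : ℝ →L[ℝ] ℝ).smulRight x) = (1 : ℝ →L[ℝ] ℝ).smulRight y := by
    rw [h2]
    exact ContinuousLinearMap.ext fun c => A.map_smul _ x
  exact (congrArg (HasMFDerivWithinAt 𝓘(ℝ, ℝ) 𝓘(ℝ, Fin (2 * k - 1 + 1) → E) (pr1 ∘ σ) I t) h3).mp h1

end UnifiedDynamics
end HigherOrder
end

open HigherOrder
theorem mainTheorem6 {E : Type*} [NormedAddCommGroup E] [NormedSpace ℝ E] [FiniteDimensional ℝ E]
    {Q : Type*} [TopologicalSpace Q] [ChartedSpace E Q] [IsManifold 𝓘(ℝ, E) ∞ Q]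
    (k : ℕ) (hk : 1 ≤ k)
    (L : HTangent E Q k → ℝ) (hL : ContMDiff 𝓘(ℝ, Fin (k + 1) → E) 𝓘(ℝ, ℝ) ∞ L)
    (X : (w : UnifiedSpace E Q k) → TangentSpace (unifiedModel E k) w)
    (hX : IsFieldOn (graphSet L) X)
    (hXtan : IsTangentToGraph L X)
    (hXsol : IsUnifiedSolution hk L X) :
    (∃! XL : (p : HTangent E Q (2 * k - 1)) → TangentSpace 𝓘(ℝ, Fin (2 * k - 1 + 1) → E) p,
      IsAssociatedField L X XL) ∧
    ∀ XL : (p : HTangent E Q (2 * k - 1)) → TangentSpace 𝓘(ℝ, Fin (2 * k - 1 + 1) → E) p,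
      IsAssociatedField L X XL →
        IsLagrangianField hk L XL ∧
        ∀ (I : Set ℝ) (σ : ℝ → UnifiedSpace E Q k), (∀ t ∈ I, σ t ∈ graphSet L) →
          IsMIntegralCurveOn (I := unifiedModel E k) σ X I →
          IsMIntegralCurveOn (I := 𝓘(ℝ, Fin (2 * k - 1 + 1) → E)) (pr1 ∘ σ) XL I := by
  refine ⟨⟨_, isAssociatedField_Tpr1 hL hX, fun XL h => funext h.eq_Tpr1⟩, fun XL h =>
    ⟨h.isLagrangianField hk hL hXtan hXsol, fun _ _ hσ hI => h.isMIntegralCurveOn hσ hI⟩⟩
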